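/- Let $A$ be an abelian group. Let $\Gamma(A)$ be Whitehead's quadratic functor: the abelian group generated by symbols $\gamma(a)$, $a\in A$, subject to $\gamma(-a)=\gamma(a)$ and $\gamma(a+b+c)-\gamma(a+b)-\gamma(a+c)-\gamma(b+c)+\gamma(a)+\gamma(b)+\gamma(c)=0$. Let $\Psi:\Gamma(A)\to A\otimes_{\mathbb Z}A$ be the homomorphism $\gamma(a)\mapsto a\otimes a$, and let $\pi: A\otimes_{\mathbb Z}A\to H_2(A,\mathbb Z)$ be the homomorphism sending $a\otimes b$ to the class of the bar cycle $[a|b]-[b|a]$. For $m\ge 1$ let ${}_mA=\{a\in A: ma=0\}$, and let ${}_{2^\infty}A=\bigcup_n {}_{2^n}A$. The group $\Sigma_2$ of order two acts on $B\otimes_{\mathbb Z}B$, for any abelian group $B$, by $a\otimes b\mapsto b\otimes a$. 1. There is an exact sequence $$0\to \lim_{I} H_1(\Sigma_2,{}_{2^n}A\otimes_{\mathbb Z}{}_{2^n}A)\to\Gamma(A)\xrightarrow{\ \Psi\ }A\otimes_{\mathbb Z}A\xrightarrow{\ \pi\ }H_2(A,\mathbb Z)\to 0,$$ and this holds with the inductive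 limit taken in either of the following two senses. (a) $\lim_I$ is the direct limit, over $n\ge 0$, of the groups $H_1(\Sigma_2,{}_{2^n}A\otimes{}_{2^n}A)$ along the maps induced by the inclusions ${}_{2^k}A\subseteq{}_{2^n}A$, $k\le n$. (b) $I$ is the inductive system of the groups ${}_sA\otimes{}_sA$, $s$ a power of $2$, in which for $n=sm$ (powers of $2$) the terms ${}_nA\otimes{}_nA$ and ${}_sA\otimes{}_sA$ are related by $a\otimes b\sim ma\otimes b$ for $a\in{}_nA$, $b\in{}_sA$, and $a\otimes b\sim a\otimes mb$ for $a\in{}_sA$, $b\in{}_nA$ (the left sides lying in ${}_nA\otimes{}_nA$, the right sides in ${}_sA\otimes{}_sA$); its limit $\lim_I({}_{2^n}A\otimes{}_{2^n}A)$ is the quotient of $\bigoplus_n {}_{2^n}A\otimes{}_{2^n}A$ by these relations, with the induced action of $\Sigma_2$, and the first term of the sequence is $H_1(\Sigma_2,\lim_I({}_{2^n}A\otimes{}_{2^n}A))$. Moreover this group is generated by the images of the groups $H_1(\Sigma_2,{}_{2^n}A\otimes{}_{2^n}A)$, $n\ge 0$. 2. In particular, if ${}_{2^\infty}A$ is finite,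 there is an exact sequence $$0\to H_1(\Sigma_2,{}_{2^\infty}A\otimes_{\mathbb Z}{}_{2^\infty}A)\to\Gamma(A)\xrightarrow{\ \Psi\ }A\otimes_{\mathbb Z}A\xrightarrow{\ \pi\ }H_2(A,\mathbb Z)\to 0.$$ -/

import Mathlib

open scoped TensorProduct DirectSum

universe u v

namespace WhiteheadQuadratic

noncomputable section

/-! ### Quadratic maps and the functor `Γ` -/

/-- Quadratic maps of abelian groups: even maps whose polarization is bilinear. -/
structure IsQuadratic {A : Type u} {B : Type v} [AddCommGroup A] [AddCommGroup B]
    (f : A → B) : Prop where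
  map_neg : ∀ a, f (-a) = f a
  add_left : ∀ a a' b, f (a + a' + b) - f (a + a') - f b =
    (f (a + b) - f a - f b) + (f (a' + b) - f a' - f b)
  add_right : ∀ a b b', f (a + (b + b')) - f a - f (b + b') =
    (f (a + b) - f a - f b) + (f (a + b') - f a - f b')

section Gamma

variable (A : Type u) [AddCommGroup A]

/-- The relations `w(a) = w(-a)` and
`w(a+b+c) - w(a+b) - w(a+c) - w(b+c) + w(a) + w(b) + w(c) = 0`
in the free abelian group on the symbols `w(a)`, `a ∈ A`. -/
def gammaRel : AddSubgroup (FreeAbelianGroup A) :=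
  AddSubgroup.closure
    ({x | ∃ a : A, x = FreeAbelianGroup.of a - FreeAbelianGroup.of (-a)} ∪
     {x | ∃ a b c : A, x = FreeAbelianGroup.of (a + b + c) - FreeAbelianGroup.of (a + b)
        - FreeAbelianGroup.of (a + c) - FreeAbelianGroup.of (b + c)
        + FreeAbelianGroup.of a + FreeAbelianGroup.of b + FreeAbelianGroup.of c})

/-- Whitehead's quadratic functor `Γ(A)`. -/
abbrev Gamma : Type u := FreeAbelianGroup A ⧸ gammaRel A

variable {A}

/-- The universal quadratic map `γ : A → Γ(A)`. -/
def gamma (a : A) : Gamma A := QuotientAddGroup.mk (FreeAbelianGroup.of a)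

/-- The homomorphism `Γ(A) → B` induced by a quadratic map `A → B`. -/
def gammaLift {B : Type v} [AddCommGroup B] (f : A → B) (hf : IsQuadratic f) : Gamma A →+ B :=
  QuotientAddGroup.lift (gammaRel A) (FreeAbelianGroup.lift f) <| by
    rw [gammaRel, AddSubgroup.closure_le]
    rintro x (⟨a, rfl⟩ | ⟨a, b, c, rfl⟩)
    · simp [hf.map_neg]
    · have h := hf.add_left a b c
      simp only [SetLike.mem_coe, AddMonoidHom.mem_ker, map_add, map_sub,
        FreeAbelianGroup.lift_apply_of]
      rw [sub_sub, sub_eq_iff_eq_add] at h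
      rw [h]
      abel

@[simp]
theorem gammaLift_gamma {B : Type v} [AddCommGroup B] (f : A → B) (hf : IsQuadratic f) (a : A) :
    gammaLift f hf (gamma a) = f a := by
  simp [gammaLift, gamma]

theorem isQuadratic_tmul_self : IsQuadratic (fun a : A => a ⊗ₜ[ℤ] a) where
  map_neg a := by simp [TensorProduct.neg_tmul, TensorProduct.tmul_neg]
  add_left a a' b := by simp only [TensorProduct.add_tmul, TensorProduct.tmul_add]; abel
  add_right a b b' := by simp only [TensorProduct.add_tmul, TensorProduct.tmul_add]; abel

variable (A) in
/-- The homomorphism `Ψ : Γ(A) → A ⊗ A`, `γ(a) ↦ a ⊗ a`. -/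
def Psi : Gamma A →+ A ⊗[ℤ] A := gammaLift (fun a => a ⊗ₜ[ℤ] a) isQuadratic_tmul_self

end Gamma

/-! ### Second integral homology

Mathlib's group homology wants the coefficient ring, the group and the module in one universe,
so `ℤ` enters as `ULift ℤ` and, below, `Σ₂` as `ULift (Equiv.Perm (Fin 2))`. -/

section H2

variable (A : Type u) [AddCommGroup A]

/-- `ℤ` with trivial action of `A`. -/
abbrev trivialRep : Rep.{u} (ULift.{u} ℤ) (Multiplicative A) :=
  Rep.trivial (ULift.{u} ℤ) (Multiplicative A) (ULift.{u} ℤ)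

/-- `H₂(A, ℤ)`. -/
abbrev H2 : ModuleCat.{u} (ULift.{u} ℤ) := groupHomology.H2 (trivialRep A)

variable {A}

/-- The inhomogeneous `2`-cycle `[a|b] - [b|a]`. -/
def commCycle (a b : A) : groupHomology.cycles₂ (trivialRep A) :=
  ⟨Finsupp.single (Multiplicative.ofAdd a, Multiplicative.ofAdd b) 1
    - Finsupp.single (Multiplicative.ofAdd b, Multiplicative.ofAdd a) 1, by
    change groupHomology.d₂₁ (trivialRep A) _ = 0
    rw [map_sub, groupHomology.d₂₁_single, groupHomology.d₂₁_single]
    simp only [Representation.isTrivial_def, LinearMap.id_apply, mul_comm]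
    abel⟩

/-- The class of `[a|b] - [b|a]` in `H₂(A, ℤ)`. -/
def commClass (a b : A) : H2 A := groupHomology.H2π (trivialRep A) (commCycle a b)

end H2

/-! ### First homology of `Σ₂` -/

section Sigma2

/-- The symmetric group on two letters. -/
abbrev Sigma2 : Type u := ULift.{u} (Equiv.Perm (Fin 2))

variable {M N : Type u} [AddCommGroup M] [AddCommGroup N]

/-- An additive map, viewed as a linear map over (the lift of) `ℤ`. -/
def toULinear (f : M →+ N) : M →ₗ[ULift.{u} ℤ] N where
  toFun := f
  map_add' := map_add f
  map_smul' c x := map_zsmul f c.down x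

/-- The representation of `Σ₂` whose nontrivial element acts by the involution `s`. -/
def involutionRep (s : M →+ M) (hs : ∀ x, s (s x) = x) :
    Representation (ULift.{u} ℤ) Sigma2.{u} M where
  toFun g := if g.down = 1 then LinearMap.id else toULinear s
  map_one' := rfl
  map_mul' := by
    have hs' : toULinear s * toULinear s = LinearMap.id := LinearMap.ext hs
    have key : ∀ g h : Equiv.Perm (Fin 2),
        (g = 1 ∧ g * h = h) ∨ (h = 1 ∧ g * h = g) ∨ (g ≠ 1 ∧ h ≠ 1 ∧ g * h = 1) := by
      decide
    rintro ⟨g⟩ ⟨h⟩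
    change (if g * h = 1 then _ else _) = (if g = 1 then _ else _) * (if h = 1 then _ else _)
    rcases key g h with ⟨h1, h2⟩ | ⟨h1, h2⟩ | ⟨h1, h2, h3⟩
    · rw [h2, if_pos h1]; rfl
    · rw [h2, if_pos h1]; rfl
    · rw [h3, if_pos rfl, if_neg h1, if_neg h2, hs']

theorem involutionRep_apply (s : M →+ M) (hs : ∀ x, s (s x) = x) (g : Sigma2.{u}) :
    involutionRep s hs g = if g.down = 1 then LinearMap.id else toULinear s := rfl

/-- `H₁(Σ₂, M)`, the nontrivial element of `Σ₂` acting on `M` by the involution `s`. -/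
abbrev H1 (s : M →+ M) (hs : ∀ x, s (s x) = x) : ModuleCat.{u} (ULift.{u} ℤ) :=
  groupHomology (Rep.of (involutionRep s hs)) 1

/-- The homomorphism `H₁(Σ₂, M) → H₁(Σ₂, N)` induced by an equivariant map `M → N`. -/
def H1map {s : M →+ M} {hs : ∀ x, s (s x) = x} {t : N →+ N} {ht : ∀ x, t (t x) = x}
    (f : M →+ N) (hf : ∀ x, f (s x) = t (f x)) :
    H1 s hs →ₗ[ULift.{u} ℤ] H1 t ht :=
  ((groupHomology.functor (ULift.{u} ℤ) Sigma2.{u} 1).map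
    (Rep.ofHom (σ := involutionRep t ht) (ρ := involutionRep s hs)
      ⟨toULinear f, by
        intro g
        ext x
        rw [involutionRep_apply, involutionRep_apply]
        split_ifs
        · rfl
        · exact hf x⟩)).hom

end Sigma2

/-! ### The square `B ⊗ B` with the interchange of factors -/

section Square

variable (B : Type u) [AddCommGroup B]

/-- The involution `a ⊗ b ↦ b ⊗ a` of `B ⊗ B`. -/
def swap : B ⊗[ℤ] B →+ B ⊗[ℤ] B := (TensorProduct.comm ℤ B B).toAddEquiv.toAddMonoidHom

@[simp] theorem swap_tmul (a b : B) : swap B (a ⊗ₜ b) = b ⊗ₜ a := rfl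

@[simp] theorem swap_swap (x : B ⊗[ℤ] B) : swap B (swap B x) = x :=
  (TensorProduct.comm ℤ B B).symm_apply_apply x

/-- `H₁(Σ₂, B ⊗ B)`, where `Σ₂` interchanges the two factors. -/
abbrev H1Square : ModuleCat.{u} (ULift.{u} ℤ) := H1 (swap B) (swap_swap B)

variable {B} {C : Type u} [AddCommGroup C]

/-- The map `f ⊗ f : B ⊗ B → C ⊗ C`, for `f : B → C`. -/
def squareMap (f : B →+ C) : B ⊗[ℤ] B →+ C ⊗[ℤ] C :=
  (TensorProduct.map f.toIntLinearMap f.toIntLinearMap).toAddMonoidHom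

@[simp] theorem squareMap_tmul (f : B →+ C) (a b : B) :
    squareMap f (a ⊗ₜ b) = f a ⊗ₜ f b := rfl

theorem squareMap_swap (f : B →+ C) (x : B ⊗[ℤ] B) :
    squareMap f (swap B x) = swap C (squareMap f x) := by
  induction x with
  | zero => simp
  | tmul a b => simp
  | add x y hx hy => simp [hx, hy]

/-- The map `H₁(Σ₂, B ⊗ B) → H₁(Σ₂, C ⊗ C)` induced by `f ⊗ f`, for `f : B → C`. -/
def H1SquareMap (f : B →+ C) : H1Square B →ₗ[ULift.{u} ℤ] H1Square C :=
  H1map (squareMap f) (squareMap_swap f)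

end Square

/-! ### Torsion and the limits -/

section Limits

variable (A : Type u) [AddCommGroup A]

/-- The subgroup of elements of `A` killed by `2 ^ n`. -/
def tors (n : ℕ) : AddSubgroup A := (zsmulAddGroupHom ((2 : ℤ) ^ n) : A →+ A).ker

/-- The `2`-power torsion subgroup of `A`. -/
def torsInf : AddSubgroup A := ⨆ n : ℕ, tors A n

variable {A}

theorem mem_tors {n : ℕ} {a : A} : a ∈ tors A n ↔ (2 : ℤ) ^ n • a = 0 := Iff.rfl

theorem tors_mono {k n : ℕ} (h : k ≤ n) : tors A k ≤ tors A n := by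
  intro a ha
  rw [mem_tors] at ha ⊢
  rw [← Nat.sub_add_cancel h, pow_add, mul_smul, ha, smul_zero]

theorem mem_torsInf {a : A} : a ∈ torsInf A ↔ ∃ n : ℕ, (2 : ℤ) ^ n • a = 0 :=
  AddSubgroup.mem_iSup_of_directed (Monotone.directed_le fun _ _ h => tors_mono h)

/-- The inclusion of the `2 ^ k`-torsion in the `2 ^ n`-torsion, for `k ≤ n`. -/
def torsIncl {k n : ℕ} (h : k ≤ n) : tors A k →+ tors A n :=
  AddSubgroup.inclusion (tors_mono h)

/-- Multiplication by `2 ^ (n - k)`, from the `2 ^ n`-torsion to the `2 ^ k`-torsion,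
for `k ≤ n`. -/
def torsMul {k n : ℕ} (h : k ≤ n) : tors A n →+ tors A k where
  toFun x := ⟨(2 : ℤ) ^ (n - k) • (x : A), by
    rw [mem_tors, smul_smul, ← pow_add, Nat.add_sub_cancel' h]
    exact x.2⟩
  map_zero' := Subtype.ext (by simp)
  map_add' x y := Subtype.ext (by simp)

variable (A)

/-- The direct limit of the groups `H₁(Σ₂, ₙA ⊗ ₙA)`, `n` running through the powers of `2`, along
the maps induced by the inclusions of torsion subgroups. -/
abbrev limH1 : Type u :=
  Module.DirectLimit (R := ULift.{u} ℤ) (fun n : ℕ => H1Square (tors A n))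
    (fun _ _ h => H1SquareMap (torsIncl h))

/-- The group `ₘA ⊗ ₘA`, where `m = 2 ^ n`. -/
abbrev torsSq (n : ℕ) : Type u := tors A n ⊗[ℤ] tors A n

/-- The direct sum of the groups `ₙA ⊗ ₙA`, `n` running through the powers of `2`. -/
abbrev torsSum : Type u := ⨁ n : ℕ, torsSq A n

instance : AddCommGroup (torsSum A) :=
  DirectSum.instAddCommGroup (β := fun n : ℕ => TensorProduct ℤ (tors A n) (tors A n))

variable {A} in
/-- The element `a ⊗ b` of the `n`-th summand. -/
abbrev tau (n : ℕ) (a b : tors A n) : torsSum A := DirectSum.of (torsSq A) n (a ⊗ₜ b)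

/-- For `n = s m`, powers of `2`, the relations `τₙ(a, b) = τₛ(m a, b)` for `a ∈ ₙA`, `b ∈ ₛA`,
and `τₙ(a, b) = τₛ(a, m b)` for `a ∈ ₛA`, `b ∈ ₙA`. -/
def torRel : AddSubgroup (torsSum A) :=
  AddSubgroup.closure
    ({x | ∃ (k n : ℕ) (h : k ≤ n) (a : tors A n) (b : tors A k),
        x = tau n a (torsIncl h b) - tau k (torsMul h a) b} ∪
     {x | ∃ (k n : ℕ) (h : k ≤ n) (a : tors A k) (b : tors A n),
        x = tau n (torsIncl h a) b - tau k a (torsMul h b)})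

/-- The inductive limit `lim_I (ₙA ⊗ ₙA)`, `n` running through the powers of `2`, over the system
`I` given by the spans `ₛA ⊗ ₛA ← ₙA ⊗ ₛA → ₙA ⊗ ₙA` and `ₛA ⊗ ₛA ← ₛA ⊗ ₙA → ₙA ⊗ ₙA` for
`s ∣ n`, whose legs are multiplication by `n / s` and inclusion. -/
abbrev torLim : Type u := torsSum A ⧸ torRel A

/-- The involution `a ⊗ b ↦ b ⊗ a` of the direct sum. -/
def torsSumSwap : torsSum A →+ torsSum A := DirectSum.map fun n => swap (tors A n)

variable {A} in
@[simp] theorem torsSumSwap_of (n : ℕ) (x : torsSq A n) :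
    torsSumSwap A (DirectSum.of (torsSq A) n x) = DirectSum.of (torsSq A) n (swap _ x) :=
  DirectSum.map_of _ _ _

theorem torRel_le : torRel A ≤ (torRel A).comap (torsSumSwap A) := by
  rw [torRel, AddSubgroup.closure_le]
  rintro x (⟨k, n, h, a, b, rfl⟩ | ⟨k, n, h, a, b, rfl⟩)
  · refine AddSubgroup.subset_closure (Or.inr ⟨k, n, h, b, a, ?_⟩)
    simp
  · refine AddSubgroup.subset_closure (Or.inl ⟨k, n, h, b, a, ?_⟩)
    simp

/-- The involution `a ⊗ b ↦ b ⊗ a` of the limit. -/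
def torLimSwap : torLim A →+ torLim A :=
  QuotientAddGroup.map (torRel A) (torRel A) (torsSumSwap A) (torRel_le A)

/-- The canonical map from the `n`-th term to the limit. -/
def toTorLim (n : ℕ) : torsSq A n →+ torLim A :=
  (QuotientAddGroup.mk' (torRel A)).comp (DirectSum.of (torsSq A) n)

theorem toTorLim_swap (n : ℕ) (x : torsSq A n) :
    toTorLim A n (swap (tors A n) x) = torLimSwap A (toTorLim A n x) :=
  (congrArg (QuotientAddGroup.mk' (torRel A)) (torsSumSwap_of n x)).symm

theorem torLimSwap_swap (x : torLim A) : torLimSwap A (torLimSwap A x) = x := by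
  obtain ⟨y, rfl⟩ := QuotientAddGroup.mk'_surjective _ x
  have h : ∀ y : torsSum A, torsSumSwap A (torsSumSwap A y) = y := by
    intro y
    induction y using DirectSum.induction_on with
    | zero => simp
    | of n z => simp
    | add y z hy hz => rw [map_add, map_add, hy, hz]
  exact congrArg (QuotientAddGroup.mk' (torRel A)) (h y)

/-- `H₁(Σ₂, lim_I (ₙA ⊗ ₙA))`, where `Σ₂` interchanges the two factors. -/
abbrev H1TorLim : ModuleCat.{u} (ULift.{u} ℤ) := H1 (torLimSwap A) (torLimSwap_swap A)

/-- The canonical map `H₁(Σ₂, ₙA ⊗ ₙA) → H₁(Σ₂, lim_I (ₙA ⊗ ₙA))`. -/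
def toH1TorLim (n : ℕ) : H1Square (tors A n) →ₗ[ULift.{u} ℤ] H1TorLim A :=
  H1map (toTorLim A n) (toTorLim_swap A n)

end Limits

end

end WhiteheadQuadratic

namespace WhiteheadQuadratic

noncomputable section

/-! ### The functor `Γ` -/

section GammaFunctor

variable {A B C : Type u} [AddCommGroup A] [AddCommGroup B] [AddCommGroup C]

/-! Exactness at `A ⊗ A` and at `H₂`. Bar chains modulo boundaries and commutators `[a|b] - [b|a]`
carry a tautological symmetric 2-cocycle on `A`. It defines an abelian extension of `A`, in which it
becomes a coboundary. This forces every 2-cycle to be a boundary plus commutators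
(`mem_commBoundaries_of_mem_cycles`), so `π` is onto. The map `[a|b] ↦ a ⊗ b` kills boundaries and
sends a cycle representing `π x` to `x - swap x`, so `ker π` consists of symmetric tensors.
Symmetric tensors are combinations of squares: one may assume `A` finitely generated, write the
identity as a sum of endomorphisms `e i` with cyclic ranges, and note that `x` agrees with the sum
of the `(e i ⊗ e i) x` up to norms, which are values of `Ψ` on polarizations.

The kernel of `Ψ`. The same splitting, with `Γ(C)` computed for cyclic `C`, shows that `ker Ψ` is
generated by the elements `2ⁿ γ(a)` with `2ⁿ a = 0` (`mem_torsionGamma_of_Psi_eq_zero`). Three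
groups are then compared with the single group `⨁ n, gr A n`:

`ker Ψ`, by `x ↦ 2ⁿ⁺¹ γ(x)`; injectivity is detected by squares of characters `A → ℤ/2ⁿ⁺¹`, which
are quadratic maps to `ℤ/2ⁿ⁺²` (`sumGamma_exact`, `sumGamma_injective`);

`H₁(Σ₂, lim_I)`, by `x ↦ [τₙ₊₁(x, x)]`; injectivity is detected by products of characters with
values in `ℤ/2` (`sumTor_surjective`, `sumTor_injective`);

`H₁(Σ₂, T ⊗ T)`, where `T` is the `2`-power torsion. For every `B`, `b ↦ [b ⊗ b]` identifies `B/2B`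
with `H₁(Σ₂, B ⊗ B)`, and `T/2T` is filtered by the images of the `2ⁿ`-torsion with graded pieces
`gr A n`. The filtration splits over the field with two elements, though not canonically
(`nonempty_gr_addEquiv`). The direct limit in sense (a) is again `H₁(Σ₂, T ⊗ T)`
(`limH1ToInf_bijective`). -/

theorem gamma_neg (a : A) : gamma (-a) = gamma a := by
  refine (QuotientAddGroup.eq_iff_sub_mem.2 ?_).symm
  exact AddSubgroup.subset_closure (Or.inl ⟨a, rfl⟩)

theorem gamma_cube (a b c : A) :
    gamma (a + b + c) - gamma (a + b) - gamma (a + c) - gamma (b + c)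
      + gamma a + gamma b + gamma c = 0 := by
  have h : FreeAbelianGroup.of (a + b + c) - FreeAbelianGroup.of (a + b)
      - FreeAbelianGroup.of (a + c) - FreeAbelianGroup.of (b + c)
      + FreeAbelianGroup.of a + FreeAbelianGroup.of b + FreeAbelianGroup.of c ∈ gammaRel A :=
    AddSubgroup.subset_closure (Or.inr ⟨a, b, c, rfl⟩)
  exact (QuotientAddGroup.eq_zero_iff _).2 h

theorem isQuadratic_gamma : IsQuadratic (gamma : A → Gamma A) where
  map_neg := gamma_neg
  add_left a a' b := by
    rw [← sub_eq_zero, ← gamma_cube a a' b]; abel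
  add_right a b b' := by
    rw [← sub_eq_zero, ← gamma_cube a b b', ← add_assoc]; abel

theorem gamma_zero : gamma (0 : A) = 0 := by
  have h := gamma_cube (0 : A) 0 0
  simp only [add_zero] at h
  simpa using h

theorem gamma_induction {p : Gamma A → Prop} (x : Gamma A) (zero : p 0)
    (of : ∀ a, p (gamma a)) (neg : ∀ x, p x → p (-x))
    (add : ∀ x y, p x → p y → p (x + y)) : p x := by
  obtain ⟨y, rfl⟩ := QuotientAddGroup.mk'_surjective _ x
  induction y using FreeAbelianGroup.induction_on with
  | zero => exact zero
  | of a => exact of a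
  | neg a h => exact neg _ h
  | add x y hx hy => rw [map_add]; exact add _ _ hx hy

theorem gamma_hom_ext {D : Type v} [AddCommGroup D] {f g : Gamma A →+ D}
    (h : ∀ a, f (gamma a) = g (gamma a)) : f = g := by
  refine DFunLike.ext _ _ fun x => ?_
  induction x using gamma_induction with
  | zero => simp
  | of a => exact h a
  | neg x hx => rw [map_neg, map_neg, hx]
  | add x y hx hy => rw [map_add, map_add, hx, hy]

theorem IsQuadratic.comp_hom {D : Type v} [AddCommGroup D] {f : B → D} (hf : IsQuadratic f)
    (g : A →+ B) : IsQuadratic (fun a => f (g a)) where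
  map_neg a := by rw [_root_.map_neg, hf.map_neg]
  add_left a a' b := by simp only [map_add]; exact hf.add_left _ _ _
  add_right a b b' := by simp only [map_add]; exact hf.add_right _ _ _

/-- The homomorphism `Γ(A) → Γ(B)` induced by a homomorphism `A → B`. -/
def gammaMap (f : A →+ B) : Gamma A →+ Gamma B :=
  gammaLift (fun a => gamma (f a)) (isQuadratic_gamma.comp_hom f)

@[simp]
theorem gammaMap_gamma (f : A →+ B) (a : A) : gammaMap f (gamma a) = gamma (f a) :=
  gammaLift_gamma _ _ _

@[simp]
theorem Psi_gamma (a : A) : Psi A (gamma a) = a ⊗ₜ a := gammaLift_gamma _ _ _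

theorem gammaMap_comp (g : B →+ C) (f : A →+ B) (x : Gamma A) :
    gammaMap (g.comp f) x = gammaMap g (gammaMap f x) := by
  refine DFunLike.congr_fun (f := gammaMap (g.comp f)) (g := (gammaMap g).comp (gammaMap f)) ?_ x
  exact gamma_hom_ext fun a => by simp

theorem gammaMap_id (x : Gamma A) : gammaMap (AddMonoidHom.id A) x = x := by
  refine DFunLike.congr_fun (f := gammaMap (AddMonoidHom.id A)) (g := AddMonoidHom.id _) ?_ x
  exact gamma_hom_ext fun a => by simp

theorem Psi_gammaMap (f : A →+ B) (x : Gamma A) :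
    Psi B (gammaMap f x) = squareMap f (Psi A x) := by
  refine DFunLike.congr_fun (f := (Psi B).comp (gammaMap f)) (g := (squareMap f).comp (Psi A)) ?_ x
  exact gamma_hom_ext fun a => by simp

/-- The polarization `A ⊗ A → Γ(A)`, `a ⊗ b ↦ γ(a + b) - γ(a) - γ(b)`. -/
def polar : A ⊗[ℤ] A →+ Gamma A :=
  TensorProduct.liftAddHom
    (AddMonoidHom.mk' (fun a => AddMonoidHom.mk' (fun b => gamma (a + b) - gamma a - gamma b)
        (isQuadratic_gamma.add_right a))
      (fun a a' => AddMonoidHom.ext (isQuadratic_gamma.add_left a a')))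
    (fun r a b => by rw [map_zsmul, map_zsmul, AddMonoidHom.zsmul_apply])

@[simp]
theorem polar_tmul (a b : A) : polar (a ⊗ₜ[ℤ] b) = gamma (a + b) - gamma a - gamma b := rfl

/-- The cube relation at `(a, a, -a)` gives `γ(2a) = 4 γ(a)`. -/
theorem polar_self (a : A) : polar (a ⊗ₜ[ℤ] a) = (2 : ℤ) • gamma a := by
  have h := gamma_cube a a (-a)
  simp only [add_neg_cancel, add_neg_cancel_right, gamma_zero, gamma_neg, sub_zero] at h
  rw [polar_tmul, ← sub_eq_zero, ← neg_eq_zero, ← h]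
  abel

theorem gamma_add (a b : A) : gamma (a + b) = gamma a + gamma b + polar (a ⊗ₜ[ℤ] b) := by
  rw [polar_tmul]; abel

theorem gamma_zsmul (k : ℤ) (a : A) : gamma (k • a) = (k * k) • gamma a := by
  have step : ∀ k : ℤ, gamma ((k + 1) • a) = gamma (k • a) + (2 * k + 1) • gamma a := by
    intro k
    rw [add_smul, one_smul, gamma_add, ← TensorProduct.smul_tmul', map_zsmul, polar_self,
      smul_smul, add_smul, one_smul, mul_comm k 2]
    abel
  induction k using Int.induction_on with
  | zero => simp [gamma_zero]
  | succ k ih =>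
    rw [step, ih, ← add_smul]; congr 1; ring
  | pred k ih =>
    have h := step (-k - 1)
    rw [sub_add_cancel, ih] at h
    rw [eq_sub_of_add_eq h.symm, ← sub_smul]; congr 1; ring

theorem Psi_polar (x : A ⊗[ℤ] A) : Psi A (polar x) = x + swap A x := by
  induction x with
  | zero => simp
  | tmul a b =>
    simp only [polar_tmul, map_sub, Psi_gamma, TensorProduct.add_tmul, TensorProduct.tmul_add,
      swap_tmul]
    abel
  | add x y hx hy => rw [map_add, map_add, hx, hy, map_add]; abel

theorem swap_Psi (x : Gamma A) : swap A (Psi A x) = Psi A x := by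
  refine DFunLike.congr_fun (f := (swap A).comp (Psi A)) (g := Psi A) ?_ x
  exact gamma_hom_ext fun a => by simp

/-- The map `f ⊗ g : A ⊗ A → B ⊗ B`. -/
def tensorMap (f g : A →+ B) : A ⊗[ℤ] A →+ B ⊗[ℤ] B :=
  (TensorProduct.map f.toIntLinearMap g.toIntLinearMap).toAddMonoidHom

@[simp] theorem tensorMap_tmul (f g : A →+ B) (a b : A) :
    tensorMap f g (a ⊗ₜ b) = f a ⊗ₜ g b := rfl

theorem gammaMap_add (f g : A →+ B) (x : Gamma A) :
    gammaMap (f + g) x = gammaMap f x + gammaMap g x + polar (tensorMap f g (Psi A x)) := by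
  refine DFunLike.congr_fun (f := gammaMap (f + g))
    (g := gammaMap f + gammaMap g + (polar.comp (tensorMap f g)).comp (Psi A)) ?_ x
  exact gamma_hom_ext fun a => by
    simp only [gammaMap_gamma, AddMonoidHom.add_apply, AddMonoidHom.comp_apply, Psi_gamma,
      tensorMap_tmul, gamma_add (f a)]

theorem gammaMap_zero (x : Gamma A) : gammaMap (0 : A →+ B) x = 0 := by
  refine DFunLike.congr_fun (f := gammaMap (0 : A →+ B)) (g := 0) ?_ x
  exact gamma_hom_ext fun a => by simp [gamma_zero]

/-- `Γ` is only a quadratic functor, but the cross term for `f + g` is the polarization of `(f ⊗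
g)(Ψ x)`. On `ker Ψ` it therefore acts additively, which lets the kernel be cut into cyclic pieces.
-/
theorem gammaMap_sum {ι : Type*} (s : Finset ι) (e : ι → A →+ B) {x : Gamma A}
    (hx : Psi A x = 0) : gammaMap (∑ i ∈ s, e i) x = ∑ i ∈ s, gammaMap (e i) x := by
  classical
  induction s using Finset.induction_on with
  | empty => simp [gammaMap_zero]
  | insert i s hi ih =>
    rw [Finset.sum_insert hi, Finset.sum_insert hi, gammaMap_add, hx, map_zero, map_zero, add_zero,
      ih]

end GammaFunctor

/-! ### `H₁(Σ₂, M)` as symmetric elements modulo norms -/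

section Involution

variable {M N : Type u} [AddCommGroup M] [AddCommGroup N]

/-- The elements fixed by an endomorphism. -/
def fixedPoints (s : M →+ M) : AddSubgroup M where
  carrier := {x | s x = x}
  zero_mem' := map_zero s
  add_mem' {x y} hx hy := by rw [Set.mem_ofPred_eq, map_add, hx, hy]
  neg_mem' {x} hx := by rw [Set.mem_ofPred_eq, map_neg, hx]

theorem mem_fixedPoints {s : M →+ M} {x : M} : x ∈ fixedPoints s ↔ s x = x := Iff.rfl

/-- The nontrivial element of `Σ₂`. -/
def flip : Sigma2.{u} := ⟨Equiv.swap 0 1⟩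

theorem flip_ne_one : flip.{u} ≠ 1 := by
  intro h
  have h' : (Equiv.swap 0 1 : Equiv.Perm (Fin 2)) = 1 := congrArg ULift.down h
  exact absurd h' (by decide)

theorem eq_one_or_eq_flip (g : Sigma2.{u}) : g = 1 ∨ g = flip := by
  have key : ∀ g : Equiv.Perm (Fin 2), g = 1 ∨ g = Equiv.swap 0 1 := by decide
  rcases g with ⟨g⟩
  rcases key g with rfl | rfl
  · exact Or.inl rfl
  · exact Or.inr rfl

theorem flip_inv : (flip.{u})⁻¹ = flip := by
  rcases eq_one_or_eq_flip (flip.{u})⁻¹ with h | h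
  · exact absurd (inv_eq_one.1 h) flip_ne_one
  · exact h

theorem flip_mul_flip : flip.{u} * flip = 1 := by
  conv_lhs => rw [← flip_inv]
  rw [flip_inv]
  conv_lhs => enter [1]; rw [← flip_inv]
  exact inv_mul_cancel _

variable (s : M →+ M) (hs : ∀ x, s (s x) = x)

theorem involutionRep_flip (x : M) : involutionRep s hs flip.{u} x = s x := by
  rw [involutionRep_apply, if_neg]
  · rfl
  · intro h
    exact flip_ne_one.{u} (congrArg ULift.up h)

theorem single_flip_mem {x : M} (hx : s x = x) :
    Finsupp.single flip.{u} x ∈ groupHomology.cycles₁ (Rep.of (involutionRep s hs)) := by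
  rw [groupHomology.single_mem_cycles₁_iff]
  exact (involutionRep_flip s hs x).trans hx

/-- The class in `H₁(Σ₂, M)` of a fixed element of the involution. -/
def H1mk : fixedPoints s →+ H1 s hs :=
  AddMonoidHom.mk' (fun x => groupHomology.H1π (Rep.of (involutionRep s hs))
    ⟨Finsupp.single flip x.1, single_flip_mem s hs x.2⟩) <| by
    intro x y
    rw [← map_add]
    congr 1
    exact Subtype.ext (Finsupp.single_add _ _ _)

/-- The part of a 1-cycle supported at the identity is a boundary. The remaining chain is supported
at `flip`, and the cycle condition says that its coefficient is fixed. -/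
theorem H1mk_surjective : Function.Surjective (H1mk s hs) := by
  intro y
  induction y using groupHomology.H1_induction_on with | @h z => ?_
  obtain ⟨z, hz⟩ := z
  have hdec : z = Finsupp.single (1 : Sigma2.{u}) (z 1) + Finsupp.single flip (z flip) := by
    ext g
    rcases eq_one_or_eq_flip g with rfl | rfl
    · simp [flip_ne_one]
    · simp [flip_ne_one.symm]
  have hb := groupHomology.single_one_mem_boundaries₁ (A := Rep.of (involutionRep s hs)) (z 1)
  have hc := groupHomology.mem_cycles₁_of_mem_boundaries₁ _ hb
  have hf : Finsupp.single flip (z flip) ∈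
      groupHomology.cycles₁ (Rep.of (involutionRep s hs)) := by
    have := Submodule.sub_mem _ hz hc
    rw [hdec] at this
    simpa [flip_ne_one.symm, flip_ne_one] using this
  have hfix : s (z flip) = z flip :=
    (involutionRep_flip s hs _).symm.trans ((groupHomology.single_mem_cycles₁_iff _ _).1 hf)
  refine ⟨⟨z flip, hfix⟩, ?_⟩
  refine ((groupHomology.H1π_eq_iff _ _).2 ?_).symm
  have : z - Finsupp.single flip (z flip) = Finsupp.single 1 (z 1) := by
    rw [sub_eq_iff_eq_add]; exact hdec
  change z - Finsupp.single flip (z flip) ∈ _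
  rw [this]
  exact hb

/-- The subgroup of norms `x + s x`. -/
def norms : AddSubgroup M := (AddMonoidHom.id M + s).range

/-- Only `[flip|flip]` contributes at `flip`, namely a norm; for the other basis chains the terms at
`flip` cancel or are absent. -/
theorem d₂₁_apply_flip (y : Sigma2.{u} × Sigma2.{u} →₀ M) :
    (groupHomology.d₂₁ (Rep.of (involutionRep s hs)) y : Sigma2.{u} →₀ M) flip ∈ norms s := by
  induction y using Finsupp.induction_linear with
  | zero => rw [map_zero]; exact zero_mem _
  | add y z hy hz => rw [map_add]; exact add_mem hy hz
  | single g a =>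
    obtain ⟨g, h⟩ := g
    rw [groupHomology.d₂₁_single]
    change (Finsupp.single h (involutionRep s hs g⁻¹ a) - Finsupp.single (g * h) a
      + Finsupp.single g a : Sigma2.{u} →₀ M) flip ∈ norms s
    have h01 := flip_ne_one.{u}
    have h10 := flip_ne_one.{u}.symm
    rcases eq_one_or_eq_flip g with rfl | rfl <;> rcases eq_one_or_eq_flip h with rfl | rfl
    · simp [h10, zero_mem]
    · simp [h10, zero_mem]
    · simp [h10, zero_mem]
    · rw [flip_mul_flip, flip_inv, involutionRep_flip]
      simp only [Finsupp.add_apply, Finsupp.sub_apply, Finsupp.single_eq_same,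
        Finsupp.single_eq_of_ne h01, sub_zero]
      exact ⟨a, add_comm _ _⟩

theorem H1mk_eq_zero_iff (x : fixedPoints s) : H1mk s hs x = 0 ↔ x.1 ∈ norms s := by
  refine (groupHomology.H1π_eq_zero_iff _).trans ⟨?_, ?_⟩
  · rintro ⟨y, hy⟩
    have h := d₂₁_apply_flip s hs y
    have h' : (Finsupp.single flip x.1 : Sigma2.{u} →₀ M) flip ∈ norms s := by
      have e : (Finsupp.single flip x.1 : Sigma2.{u} →₀ M) flip =
        (groupHomology.d₂₁ (Rep.of (involutionRep s hs)) y : Sigma2.{u} →₀ M) flip :=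
          congrArg (fun z : Sigma2.{u} →₀ M => z flip) hy.symm
      rw [e]; exact h
    simpa using h'
  · rintro ⟨y, hy⟩
    have h := groupHomology.single_ρ_self_add_single_inv_mem_boundaries₁
      (A := Rep.of (involutionRep s hs)) flip y
    rw [flip_inv] at h
    change Finsupp.single flip (involutionRep s hs flip y) + Finsupp.single flip y ∈ _ at h
    rw [involutionRep_flip, ← Finsupp.single_add] at h
    change Finsupp.single flip x.1 ∈ _
    rw [← hy, AddMonoidHom.add_apply, AddMonoidHom.id_apply, add_comm]
    exact h

variable {s hs} {t : N →+ N} {ht : ∀ x, t (t x) = x}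

theorem H1map_H1mk (f : M →+ N) (hf : ∀ x, f (s x) = t (f x)) (x : fixedPoints s) :
    H1map (hs := hs) (ht := ht) f hf (H1mk s hs x) =
      H1mk t ht ⟨f x.1, by rw [mem_fixedPoints, ← hf, x.2]⟩ := by
  refine (groupHomology.H1π_comp_map_apply _ _ _).trans ?_
  refine congrArg _ (Subtype.ext ?_)
  refine (groupHomology.coe_mapCycles₁ _ _ _).trans ?_
  simp [groupHomology.chainsMap₁]
  rfl

end Involution

/-! ### The second homology of an abelian group -/

section SecondHomology

variable {A : Type u} [AddCommGroup A]

/-- The bar `2`-chain `[a|b]`. -/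
def bar (a b : A) : Multiplicative A × Multiplicative A →₀ ULift.{u} ℤ :=
  Finsupp.single (Multiplicative.ofAdd a, Multiplicative.ofAdd b) 1

theorem bar_cocycle_mem (a b c : A) :
    bar b c - bar (a + b) c + bar a (b + c) - bar a b ∈
      groupHomology.boundaries₂ (trivialRep A) := by
  refine ⟨Finsupp.single (Multiplicative.ofAdd a, Multiplicative.ofAdd b,
    Multiplicative.ofAdd c) 1, ?_⟩
  refine (groupHomology.d₃₂_single _ _).trans ?_
  rfl

theorem coe_commCycle (a b : A) : (commCycle a b).1 = bar a b - bar b a := rfl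

theorem commClass_add_left (a a' b : A) :
    commClass (a + a') b = commClass a b + commClass a' b := by
  rw [commClass, commClass, commClass, ← map_add]
  refine (groupHomology.H2π_eq_iff _ _).2 ?_
  rw [Submodule.coe_add, coe_commCycle, coe_commCycle, coe_commCycle]
  -- These are the boundaries of the three shuffles of `[a|a']` with `[b]`, taken with alternating
  -- signs.
  have h := neg_mem (add_mem (sub_mem (bar_cocycle_mem a a' b) (bar_cocycle_mem a b a'))
    (bar_cocycle_mem b a a'))
  convert h using 1
  rw [add_comm b a, add_comm b a']
  abel

theorem commClass_swap (a b : A) : commClass b a = -commClass a b := by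
  rw [commClass, commClass, ← map_neg]
  congr 1
  refine Subtype.ext ?_
  rw [Submodule.coe_neg, coe_commCycle, coe_commCycle, neg_sub]

theorem commClass_add_right (a b b' : A) :
    commClass a (b + b') = commClass a b + commClass a b' := by
  rw [commClass_swap (b + b') a, commClass_swap b a, commClass_swap b' a, commClass_add_left,
    neg_add]

variable (A) in
/-- The homomorphism `π : A ⊗ A → H₂(A, ℤ)`, `a ⊗ b ↦ [a|b] - [b|a]`. -/
def commHom : A ⊗[ℤ] A →+ H2 A :=
  TensorProduct.liftAddHom
    (AddMonoidHom.mk' (fun a => AddMonoidHom.mk' (fun b => commClass a b)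
        (commClass_add_right a))
      (fun a a' => AddMonoidHom.ext (commClass_add_left a a')))
    (fun r a b => by rw [map_zsmul, map_zsmul, AddMonoidHom.zsmul_apply])

@[simp] theorem commHom_tmul (a b : A) : commHom A (a ⊗ₜ b) = commClass a b := rfl

theorem commHom_Psi (x : Gamma A) : commHom A (Psi A x) = 0 := by
  refine DFunLike.congr_fun (f := (commHom A).comp (Psi A)) (g := 0) ?_ x
  refine gamma_hom_ext fun a => ?_
  simp only [AddMonoidHom.comp_apply, Psi_gamma, commHom_tmul, AddMonoidHom.zero_apply]
  have h : commCycle a a = 0 := Subtype.ext (sub_self _)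
  rw [commClass, h, map_zero]

/-- The homomorphism `[a|b] ↦ a ⊗ b` from bar `2`-chains. -/
def barTensor : (Multiplicative A × Multiplicative A →₀ ULift.{u} ℤ) →+ A ⊗[ℤ] A :=
  Finsupp.liftAddHom fun p => ((zmultiplesHom (A ⊗[ℤ] A)
    (p.1.toAdd ⊗ₜ[ℤ] p.2.toAdd)).comp AddEquiv.ulift.toAddMonoidHom)

theorem barTensor_single (a b : Multiplicative A) (n : ULift.{u} ℤ) :
    barTensor (Finsupp.single (a, b) n) = n.down • (a.toAdd ⊗ₜ[ℤ] b.toAdd) := by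
  simp only [barTensor, Finsupp.liftAddHom_apply_single]
  rfl

theorem barTensor_bar (a b : A) : barTensor (bar a b) = a ⊗ₜ b := by
  rw [bar, barTensor_single]; exact one_smul _ _

theorem barTensor_boundary {x : Multiplicative A × Multiplicative A →₀ ULift.{u} ℤ}
    (hx : x ∈ groupHomology.boundaries₂ (trivialRep A)) : barTensor x = 0 := by
  obtain ⟨y, rfl⟩ := hx
  induction y using Finsupp.induction_linear with
  | zero => rw [map_zero]; exact map_zero _
  | add y z hy hz => rw [map_add]; refine (map_add _ _ _).trans ?_; rw [hy, hz, add_zero]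
  | single g n =>
    obtain ⟨a, b, c⟩ := g
    refine (congrArg barTensor (groupHomology.d₃₂_single _ _)).trans ?_
    change barTensor (Finsupp.single (b, c) n - Finsupp.single (a * b, c) n
      + Finsupp.single (a, b * c) n - Finsupp.single (a, b) n) = 0
    simp only [map_sub, map_add, barTensor_single, toAdd_mul, TensorProduct.add_tmul,
      TensorProduct.tmul_add, smul_add]
    abel

/-- A homology class determines its cycle only up to boundaries, so the cycle and its value under
`barTensor` are tracked together. -/
theorem exists_commHom_lift (x : A ⊗[ℤ] A) :
    ∃ z : groupHomology.cycles₂ (trivialRep A),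
      groupHomology.H2π (trivialRep A) z = commHom A x ∧ barTensor z.1 = x - swap A x := by
  induction x with
  | zero => exact ⟨0, by simp, by rw [map_zero, sub_zero]; exact map_zero _⟩
  | tmul a b =>
    refine ⟨commCycle a b, rfl, ?_⟩
    rw [coe_commCycle, map_sub, barTensor_bar, barTensor_bar, swap_tmul]
  | add x y hx hy =>
    obtain ⟨z, h1, h2⟩ := hx
    obtain ⟨w, h3, h4⟩ := hy
    refine ⟨z + w, by rw [map_add, map_add, h1, h3], ?_⟩
    rw [Submodule.coe_add, map_add, h2, h4, map_add]
    abel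

/-- If `π x = 0`, the cycle representing it is a boundary, so its image `x - swap x` in `A ⊗ A`
vanishes. -/
theorem swap_eq_of_commHom_eq_zero {x : A ⊗[ℤ] A} (hx : commHom A x = 0) : swap A x = x := by
  obtain ⟨z, h1, h2⟩ := exists_commHom_lift x
  rw [hx] at h1
  rw [barTensor_boundary ((groupHomology.H2π_eq_zero_iff _).1 h1)] at h2
  exact (sub_eq_zero.1 h2.symm).symm

/-- A symmetric `2`-cocycle of an abelian group, not necessarily normalized. -/
structure IsSymmetricCocycle {Q : Type u} [AddCommGroup Q] (f : A → A → Q) : Prop where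
  symm : ∀ a b, f a b = f b a
  cocycle : ∀ a b c, f b c + f a (b + c) = f (a + b) c + f a b

/-- The abelian extension defined by a symmetric cocycle: the product with twisted addition. -/
@[ext] structure CocycleExt {Q : Type u} [AddCommGroup Q] (f : A → A → Q) where
  fst : Q
  snd : A

section CocycleExt

variable {Q : Type u} [AddCommGroup Q] {f : A → A → Q}

theorem IsSymmetricCocycle.zero_left (hf : IsSymmetricCocycle f) (a : A) : f 0 a = f 0 0 := by
  have h := hf.cocycle 0 0 a
  simp only [zero_add] at h
  exact add_left_cancel h

/-- The group structure on the extension. -/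
@[reducible] def cocycleExtGroup (hf : IsSymmetricCocycle f) : AddCommGroup (CocycleExt f) :=
  letI : Add (CocycleExt f) := ⟨fun x y => ⟨x.fst + y.fst + f x.snd y.snd, x.snd + y.snd⟩⟩
  -- Since `f` need not be normalized, the neutral element is shifted by the constant `f 0 0 = f 0
  -- a`.
  letI : Zero (CocycleExt f) := ⟨⟨-f 0 0, 0⟩⟩
  letI : Neg (CocycleExt f) := ⟨fun x => ⟨-x.fst - f (-x.snd) x.snd - f 0 0, -x.snd⟩⟩
  have comm : ∀ x y : CocycleExt f, x + y = y + x := fun x y => by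
    refine CocycleExt.ext ?_ (add_comm _ _)
    change x.fst + y.fst + f x.snd y.snd = y.fst + x.fst + f y.snd x.snd
    rw [hf.symm, add_comm x.fst]
  have zero_add' : ∀ x : CocycleExt f, 0 + x = x := fun x => by
    refine CocycleExt.ext ?_ (zero_add _)
    change -f 0 0 + x.fst + f 0 x.snd = x.fst
    rw [hf.zero_left x.snd]; abel
  { add_assoc := fun x y z => by
      refine CocycleExt.ext ?_ (add_assoc _ _ _)
      change x.fst + y.fst + f x.snd y.snd + z.fst + f (x.snd + y.snd) z.snd =
        x.fst + (y.fst + z.fst + f y.snd z.snd) + f x.snd (y.snd + z.snd)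
      have h := hf.cocycle x.snd y.snd z.snd
      rw [← sub_eq_zero] at h ⊢
      rw [← neg_eq_zero, ← h]
      abel
    zero_add := zero_add'
    add_zero := fun x => (comm x 0).trans (zero_add' x)
    neg_add_cancel := fun x => by
      refine CocycleExt.ext ?_ (neg_add_cancel _)
      change -x.fst - f (-x.snd) x.snd - f 0 0 + x.fst + f (-x.snd) x.snd = -f 0 0
      abel
    add_comm := comm
    nsmul := nsmulRec
    zsmul := zsmulRec }

/-- A symmetric cocycle becomes a coboundary in a larger abelian group. -/
theorem exists_hom_of_isSymmetricCocycle (hf : IsSymmetricCocycle f) :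
    ∃ (E : Type u) (_ : AddCommGroup E) (i : Q →+ E) (φ : A → E),
      Function.Injective i ∧ ∀ a b, φ a + φ b - φ (a + b) = i (f a b) := by
  let _ := cocycleExtGroup hf
  have hadd : ∀ x y : CocycleExt f,
    x + y = ⟨x.fst + y.fst + f x.snd y.snd, x.snd + y.snd⟩ := fun _ _ => rfl
  -- The embedding of `Q` carries the same shift by `f 0 0`; `φ` is the set-theoretic section `a ↦
  -- (0, a)`.
  refine ⟨CocycleExt f, inferInstance,
    AddMonoidHom.mk' (fun q => ⟨q - f 0 0, 0⟩) ?_, fun a => ⟨0, a⟩, ?_, ?_⟩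
  · intro q r
    rw [hadd]
    refine CocycleExt.ext ?_ (add_zero _).symm
    change q + r - f 0 0 = q - f 0 0 + (r - f 0 0) + f 0 0
    abel
  · intro q r h
    exact sub_left_injective (congrArg CocycleExt.fst h)
  · intro a b
    rw [sub_eq_iff_eq_add, hadd, AddMonoidHom.mk'_apply, hadd]
    refine CocycleExt.ext ?_ (zero_add _).symm
    change 0 + 0 + f a b = f a b - f 0 0 + 0 + f 0 (a + b)
    rw [hf.zero_left (a + b)]
    abel

end CocycleExt

variable (A) in
/-- Boundaries and commutator cycles. -/
def commBoundaries :
    AddSubgroup (Multiplicative A × Multiplicative A →₀ ULift.{u} ℤ) :=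
  (groupHomology.boundaries₂ (trivialRep A)).toAddSubgroup ⊔
    AddSubgroup.closure {x | ∃ a b : A, x = bar a b - bar b a}

/-- The class of `[a|b]` modulo boundaries and commutators. -/
def barClass (a b : A) :
    (Multiplicative A × Multiplicative A →₀ ULift.{u} ℤ) ⧸ commBoundaries A :=
  QuotientAddGroup.mk (bar a b)

theorem isSymmetricCocycle_barClass : IsSymmetricCocycle (barClass (A := A)) where
  symm a b := QuotientAddGroup.eq_iff_sub_mem.2
    (AddSubgroup.mem_sup_right (AddSubgroup.subset_closure ⟨a, b, rfl⟩))
  cocycle a b c := by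
    refine QuotientAddGroup.eq_iff_sub_mem.2 (AddSubgroup.mem_sup_left ?_)
    change _ ∈ groupHomology.boundaries₂ (trivialRep A)
    have h := bar_cocycle_mem a b c
    rwa [sub_add_eq_add_sub, sub_sub] at h

theorem single_eq_zsmul_bar {B : Type u} (a b : B) (n : ULift.{u} ℤ) :
    Finsupp.single (Multiplicative.ofAdd a, Multiplicative.ofAdd b) n = n.down • bar a b := by
  rw [bar, Finsupp.smul_single]
  congr 1
  exact ULift.ext _ _ (by simp)

/-- The classes of `[a|b]` modulo boundaries and commutators form a symmetric cocycle with values in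
a quotient `Q`. In the abelian extension `E` it is the coboundary of `φ`. Extending `φ` to a
homomorphism `F` on 1-chains, `F ∘ d` equals the projection to `Q` followed by the injection `Q →
E`; hence a cycle has zero class in `Q`. -/
theorem mem_commBoundaries_of_mem_cycles
    {z : Multiplicative A × Multiplicative A →₀ ULift.{u} ℤ}
    (hz : z ∈ groupHomology.cycles₂ (trivialRep A)) : z ∈ commBoundaries A := by
  obtain ⟨E, _, i, φ, hi, hφ⟩ := exists_hom_of_isSymmetricCocycle
    (isSymmetricCocycle_barClass (A := A))
  let F : (Multiplicative A →₀ ULift.{u} ℤ) →+ E :=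
    Finsupp.liftAddHom fun a =>
      (zmultiplesHom E (φ a.toAdd)).comp AddEquiv.ulift.toAddMonoidHom
  have hF : ∀ (a : Multiplicative A) (n : ULift.{u} ℤ),
      F (Finsupp.single a n) = n.down • φ a.toAdd := fun a n => by
      simp only [F, Finsupp.liftAddHom_apply_single]
      rfl
  have key : ∀ y : Multiplicative A × Multiplicative A →₀ ULift.{u} ℤ,
      F (groupHomology.d₂₁ (trivialRep A) y) =
        i (QuotientAddGroup.mk' (commBoundaries A) y) := by
    intro y
    induction y using Finsupp.induction_linear with
    | zero => simp only [map_zero]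
    | add y w hy hw =>
      rw [map_add, map_add]
      exact (congrArg₂ (· + ·) hy hw).trans (map_add i _ _).symm
    | single g n =>
      obtain ⟨a, b⟩ := g
      refine (congrArg F (groupHomology.d₂₁_single _ _)).trans ?_
      change F (Finsupp.single b n - Finsupp.single (a * b) n + Finsupp.single a n) = _
      have h := single_eq_zsmul_bar a.toAdd b.toAdd n
      rw [ofAdd_toAdd, ofAdd_toAdd] at h
      rw [h, map_zsmul, map_zsmul, map_add, map_sub, hF, hF, hF]
      change _ = n.down • i (barClass a.toAdd b.toAdd)
      rw [← hφ, smul_sub, smul_add, toAdd_mul]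
      abel
  have h0 : F (groupHomology.d₂₁ (trivialRep A) z) = 0 :=
    (congrArg F hz).trans (map_zero F)
  rw [key] at h0
  exact (QuotientAddGroup.eq_zero_iff z).1 ((injective_iff_map_eq_zero i).1 hi _ h0)

theorem commHom_surjective : Function.Surjective (commHom A) := by
  intro y
  induction y using groupHomology.H2_induction_on with | @h z => ?_
  obtain ⟨z, hz⟩ := z
  obtain ⟨b, hb, c, hc, hbc⟩ := AddSubgroup.mem_sup.1 (mem_commBoundaries_of_mem_cycles hz)
  have hb' : b ∈ groupHomology.boundaries₂ (trivialRep A) := hb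
  have hlift : ∃ x : A ⊗[ℤ] A, ∃ h : c ∈ groupHomology.cycles₂ (trivialRep A),
      commHom A x = groupHomology.H2π (trivialRep A) ⟨c, h⟩ := by
    clear hbc
    induction hc using AddSubgroup.closure_induction with
    | mem c hc =>
      obtain ⟨a, b, rfl⟩ := hc
      exact ⟨a ⊗ₜ b, (commCycle a b).2, rfl⟩
    | zero => exact ⟨0, zero_mem _, by rw [map_zero]; exact (map_zero _).symm⟩
    | add c d _ _ hc hd =>
      obtain ⟨x, h, hx⟩ := hc
      obtain ⟨y, h', hy⟩ := hd
      refine ⟨x + y, add_mem h h', ?_⟩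
      rw [map_add, hx, hy, ← map_add]
      rfl
    | neg c _ hc =>
      obtain ⟨x, h, hx⟩ := hc
      refine ⟨-x, neg_mem h, ?_⟩
      rw [map_neg, hx, ← map_neg]
      rfl
  obtain ⟨x, h, hx⟩ := hlift
  refine ⟨x, hx.trans ((groupHomology.H2π_eq_iff _ _).2 ?_)⟩
  change c - z ∈ _
  rw [← hbc, sub_add_cancel_right]
  exact neg_mem hb'

end SecondHomology

/-! ### Reduction to cyclic groups -/

section Splitting

theorem isAddCyclic_range_of_factor {A B C : Type*} [AddCommGroup A] [AddCommGroup B]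
    [AddCommGroup C] [IsAddCyclic B] (f : B →+ C) (g : A →+ B) :
    IsAddCyclic (f.comp g).range := by
  have : IsAddCyclic f.range := isAddCyclic_of_surjective f.rangeRestrict f.rangeRestrict_surjective
  have hle : (f.comp g).range ≤ f.range := by
    rintro _ ⟨x, rfl⟩
    exact ⟨g x, rfl⟩
  exact isAddCyclic_of_injective (AddSubgroup.inclusion hle) (AddSubgroup.inclusion_injective hle)

/-- The identity of a finitely generated abelian group is a finite sum of endomorphisms with
cyclic ranges. -/
theorem exists_sum_cyclic_eq_id (A : Type u) [AddCommGroup A] [AddGroup.FG A] :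
    ∃ (ι : Type) (_ : Fintype ι) (e : ι → A →+ A),
      ∑ i, e i = AddMonoidHom.id A ∧ ∀ i, IsAddCyclic (e i).range := by
  classical
  obtain ⟨n, κ, _, p, -, m, ⟨φ⟩⟩ := AddCommGroup.equiv_free_prod_directSum_zmod A
  let e₁ : Fin n → A →+ A := fun i =>
    (φ.symm.toAddMonoidHom.comp ((AddMonoidHom.inl _ _).comp (Finsupp.singleAddHom i))).comp
      (((Finsupp.applyAddHom i).comp (AddMonoidHom.fst _ _)).comp φ.toAddMonoidHom)
  let e₂ : κ → A →+ A := fun i =>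
    (φ.symm.toAddMonoidHom.comp ((AddMonoidHom.inr _ _).comp
      (DirectSum.of (fun i => ZMod (p i ^ m i)) i))).comp
      (((DFinsupp.evalAddMonoidHom i).comp (AddMonoidHom.snd _ _)).comp φ.toAddMonoidHom)
  refine ⟨Fin n ⊕ κ, inferInstance, Sum.elim e₁ e₂, ?_, ?_⟩
  · ext a
    apply φ.injective
    rw [Fintype.sum_sum_type, AddMonoidHom.add_apply, AddMonoidHom.finsetSum_apply,
      AddMonoidHom.finsetSum_apply, map_add, map_sum, map_sum, AddMonoidHom.id_apply]
    have h₁ : ∀ i, φ (e₁ i a) = (Finsupp.single i ((φ a).1 i), 0) := fun i =>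
      φ.apply_symm_apply _
    have h₂ : ∀ i, φ (e₂ i a) = (0, DirectSum.of (fun i => ZMod (p i ^ m i)) i ((φ a).2 i)) :=
      fun i => φ.apply_symm_apply _
    simp only [Sum.elim_inl, Sum.elim_inr, h₁, h₂]
    refine Prod.ext ?_ ?_
    · simp [Prod.fst_sum, Finsupp.univ_sum_single]
    · simp only [Prod.snd_add, Prod.snd_sum, Finset.sum_const_zero, zero_add]
      exact DirectSum.sum_univ_of _
  · rintro (i | i)
    · exact isAddCyclic_range_of_factor _ _
    · exact isAddCyclic_range_of_factor _ _

variable {A B : Type u} [AddCommGroup A] [AddCommGroup B]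

theorem norm_mem_norms {M : Type u} [AddCommGroup M] (s : M →+ M) (x : M) :
    x + s x ∈ norms s := ⟨x, rfl⟩

/-- On symmetric elements the diagonal of a biadditive family of maps compatible with the
involutions is additive modulo norms. -/
theorem diagonal_sum_sub_mem_norms {M N : Type u} [AddCommGroup M] [AddCommGroup N]
    (s : M →+ M) (t : N →+ N) (T : (A →+ B) → (A →+ B) → M →+ N)
    (add_left : ∀ f f' g, T (f + f') g = T f g + T f' g)
    (add_right : ∀ f g g', T f (g + g') = T f g + T f g')
    (symm : ∀ f g x, T g f (s x) = t (T f g x)) {x : M} (hx : s x = x)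
    {ι : Type*} (I : Finset ι) (e : ι → A →+ B) :
    T (∑ i ∈ I, e i) (∑ i ∈ I, e i) x - ∑ i ∈ I, T (e i) (e i) x ∈ norms t := by
  classical
  induction I using Finset.induction_on with
  | empty =>
    have h : T 0 0 = 0 := by simpa using add_left 0 0 0
    simp [h, zero_mem]
  | insert i I hi ih =>
    rw [Finset.sum_insert hi, Finset.sum_insert hi, add_left, add_right, add_right]
    -- As `x` is fixed, `t` interchanges the two cross terms, so that their sum is a norm.
    have h := symm (e i) (∑ j ∈ I, e j) x
    rw [hx] at h
    have h2 := add_mem ih (norm_mem_norms t (T (e i) (∑ j ∈ I, e j) x))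
    rw [← h] at h2
    convert h2 using 1
    simp only [AddMonoidHom.add_apply]
    abel

end Splitting

/-! ### Reduction to finitely generated subgroups -/

section Locality

variable {A : Type u} [AddCommGroup A]

/-- The subgroup generated by a finite set. -/
abbrev fgSub (s : Finset A) : AddSubgroup A := AddSubgroup.closure (s : Set A)

instance (s : Finset A) : AddGroup.FG (fgSub s) := AddGroup.closure_finset_fg s

theorem fgSub_mono {s t : Finset A} (h : s ≤ t) : fgSub s ≤ fgSub t :=
  AddSubgroup.closure_mono (Finset.coe_subset.2 h)

theorem mem_fgSub {s : Finset A} {a : A} (h : a ∈ s) : a ∈ fgSub s :=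
  AddSubgroup.subset_closure h

/-- The inclusion of finitely generated subgroups. -/
def fgIncl {s t : Finset A} (h : s ≤ t) : fgSub s →+ fgSub t :=
  AddSubgroup.inclusion (fgSub_mono h)

theorem squareMap_comp {B C : Type u} [AddCommGroup B] [AddCommGroup C] (g : B →+ C) (f : A →+ B)
    (x : A ⊗[ℤ] A) : squareMap (g.comp f) x = squareMap g (squareMap f x) := by
  induction x with
  | zero => simp
  | tmul a b => rfl
  | add x y hx hy => rw [map_add, map_add, map_add, hx, hy]

theorem squareMap_id (x : A ⊗[ℤ] A) : squareMap (AddMonoidHom.id A) x = x := by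
  induction x with
  | zero => simp
  | tmul a b => rfl
  | add x y hx hy => rw [map_add, hx, hy]

instance squareSystem : DirectedSystem (fun s : Finset A => fgSub s ⊗[ℤ] fgSub s)
    (fun _ _ h => squareMap (fgIncl h)) where
  map_self _ x := squareMap_id x
  map_map _ _ _ _ _ x := (squareMap_comp _ _ x).symm

open scoped Classical in
variable (A) in
/-- The direct limit of the tensor squares of the finitely generated subgroups. -/
abbrev squareLim : Type u :=
  AddCommGroup.DirectLimit (fun s : Finset A => fgSub s ⊗[ℤ] fgSub s)
    (fun _ _ h => squareMap (fgIncl h))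

open scoped Classical in
/-- The canonical map to the direct limit. -/
def squareLimOf (s : Finset A) : fgSub s ⊗[ℤ] fgSub s →+ squareLim A :=
  AddCommGroup.DirectLimit.of (fun s : Finset A => fgSub s ⊗[ℤ] fgSub s)
    (fun _ _ h => squareMap (fgIncl h)) s

theorem squareLimOf_map {s t : Finset A} (h : s ≤ t) (x : fgSub s ⊗[ℤ] fgSub s) :
    squareLimOf t (squareMap (fgIncl h) x) = squareLimOf s x := by
  classical
  exact AddCommGroup.DirectLimit.of_f
    (G := fun s : Finset A => fgSub s ⊗[ℤ] fgSub s) (f := fun _ _ h => squareMap (fgIncl h)) h x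

open scoped Classical in
/-- The class of `a ⊗ b` in the limit. -/
def squareLimTmul (a b : A) : squareLim A :=
  squareLimOf {a, b} (⟨a, mem_fgSub (by simp)⟩ ⊗ₜ ⟨b, mem_fgSub (by simp)⟩)

theorem squareLimTmul_eq {s : Finset A} (a b : fgSub s) :
    squareLimTmul (a : A) b = squareLimOf s (a ⊗ₜ b) := by
  classical
  rw [squareLimTmul, ← squareLimOf_map (Finset.subset_union_left (s₂ := s)),
    ← squareLimOf_map (Finset.subset_union_right (s₁ := {(a : A), (b : A)}) (s₂ := s))]
  rfl

/-- The map from the tensor square to the direct limit. -/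
def toSquareLim : A ⊗[ℤ] A →+ squareLim A :=
  TensorProduct.liftAddHom
    (AddMonoidHom.mk' (fun a => AddMonoidHom.mk' (fun b => squareLimTmul a b)
        (fun b b' => by
          classical
          let s : Finset A := {a, b, b'}
          let a₀ : fgSub s := ⟨a, mem_fgSub (by simp [s])⟩
          let b₀ : fgSub s := ⟨b, mem_fgSub (by simp [s])⟩
          let c₀ : fgSub s := ⟨b', mem_fgSub (by simp [s])⟩
          change squareLimTmul (a₀ : A) ((b₀ + c₀ : fgSub s) : A) =
            squareLimTmul (a₀ : A) b₀ + squareLimTmul (a₀ : A) c₀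
          simp only [squareLimTmul_eq, TensorProduct.tmul_add, map_add]))
      (fun a a' => AddMonoidHom.ext fun b => by
          classical
          let s : Finset A := {a, a', b}
          let a₀ : fgSub s := ⟨a, mem_fgSub (by simp [s])⟩
          let c₀ : fgSub s := ⟨a', mem_fgSub (by simp [s])⟩
          let b₀ : fgSub s := ⟨b, mem_fgSub (by simp [s])⟩
          change squareLimTmul ((a₀ + c₀ : fgSub s) : A) (b₀ : A) =
            squareLimTmul (a₀ : A) b₀ + squareLimTmul (c₀ : A) b₀
          simp only [squareLimTmul_eq, TensorProduct.add_tmul, map_add]))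
    (fun r a b => by rw [map_zsmul, map_zsmul, AddMonoidHom.zsmul_apply])

theorem toSquareLim_map {s : Finset A} (x : fgSub s ⊗[ℤ] fgSub s) :
    toSquareLim (squareMap (fgSub s).subtype x) = squareLimOf s x := by
  induction x with
  | zero => simp
  | tmul a b => exact squareLimTmul_eq a b
  | add x y hx hy => rw [map_add, map_add, map_add, hx, hy]

/-- Inclusions need not induce injections on tensor squares. The map to the direct limit, however,
factors through `A ⊗ A` by `toSquareLim`, so an element that dies in `A ⊗ A` dies in the limit,
hence at a finite stage. -/
theorem exists_squareMap_fgIncl_eq_zero {s : Finset A} {x : fgSub s ⊗[ℤ] fgSub s}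
    (hx : squareMap (fgSub s).subtype x = 0) :
    ∃ (t : Finset A) (h : s ≤ t), squareMap (fgIncl h) x = 0 := by
  classical
  have h : squareLimOf s x = 0 := by rw [← toSquareLim_map, hx, map_zero]
  exact AddCommGroup.DirectLimit.of.zero_exact
    (G := fun s : Finset A => fgSub s ⊗[ℤ] fgSub s) (f := fun _ _ h => squareMap (fgIncl h)) s x h

theorem exists_squareMap_fgSub_eq (x : A ⊗[ℤ] A) :
    ∃ (s : Finset A) (y : fgSub s ⊗[ℤ] fgSub s), squareMap (fgSub s).subtype y = x := by
  classical
  induction x with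
  | zero => exact ⟨∅, 0, map_zero _⟩
  | tmul a b =>
    exact ⟨{a, b}, ⟨a, mem_fgSub (by simp)⟩ ⊗ₜ ⟨b, mem_fgSub (by simp)⟩, rfl⟩
  | add x y hx hy =>
    obtain ⟨s, x, rfl⟩ := hx
    obtain ⟨t, y, rfl⟩ := hy
    refine ⟨s ∪ t, squareMap (fgIncl Finset.subset_union_left) x +
      squareMap (fgIncl Finset.subset_union_right) y, ?_⟩
    rw [map_add, ← squareMap_comp, ← squareMap_comp]
    rfl

theorem exists_gammaMap_fgSub_eq (x : Gamma A) :
    ∃ (s : Finset A) (y : Gamma (fgSub s)), gammaMap (fgSub s).subtype y = x := by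
  classical
  induction x using gamma_induction with
  | zero => exact ⟨∅, 0, map_zero _⟩
  | of a => exact ⟨{a}, gamma ⟨a, mem_fgSub (by simp)⟩, gammaMap_gamma _ _⟩
  | neg x hx =>
    obtain ⟨s, x, rfl⟩ := hx
    exact ⟨s, -x, map_neg _ _⟩
  | add x y hx hy =>
    obtain ⟨s, x, rfl⟩ := hx
    obtain ⟨t, y, rfl⟩ := hy
    refine ⟨s ∪ t, gammaMap (fgIncl Finset.subset_union_left) x +
      gammaMap (fgIncl Finset.subset_union_right) y, ?_⟩
    rw [map_add, ← gammaMap_comp, ← gammaMap_comp]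
    rfl

end Locality

/-! ### Symmetric tensors and the kernel of `Ψ` -/

section Kernel

variable {A : Type u} [AddCommGroup A]

theorem mem_range_Psi_of_isAddCyclic [IsAddCyclic A] (x : A ⊗[ℤ] A) : x ∈ (Psi A).range := by
  obtain ⟨g, hg⟩ := IsAddCyclic.exists_generator (α := A)
  induction x with
  | zero => exact zero_mem _
  | tmul a b =>
    obtain ⟨k, rfl⟩ := hg a
    obtain ⟨l, rfl⟩ := hg b
    refine ⟨(k * l) • gamma g, ?_⟩
    rw [map_zsmul, Psi_gamma, mul_smul]
    exact (congrArg (k • ·) (TensorProduct.tmul_smul l g g).symm).trans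
      (TensorProduct.smul_tmul' k g (l • g))
  | add x y hx hy => exact add_mem hx hy

theorem tensorMap_add_left {B : Type u} [AddCommGroup B] (f f' g : A →+ B) :
    tensorMap (f + f') g = tensorMap f g + tensorMap f' g :=
  DFunLike.ext _ _ fun x => by
    induction x with
    | zero => simp
    | tmul a b => exact TensorProduct.add_tmul _ _ _
    | add x y hx hy => rw [map_add, map_add, hx, hy]

theorem tensorMap_add_right {B : Type u} [AddCommGroup B] (f g g' : A →+ B) :
    tensorMap f (g + g') = tensorMap f g + tensorMap f g' :=
  DFunLike.ext _ _ fun x => by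
    induction x with
    | zero => simp
    | tmul a b => exact TensorProduct.tmul_add _ _ _
    | add x y hx hy => rw [map_add, map_add, hx, hy]

theorem tensorMap_swap {B : Type u} [AddCommGroup B] (f g : A →+ B) (x : A ⊗[ℤ] A) :
    tensorMap g f (swap A x) = swap B (tensorMap f g x) := by
  induction x with
  | zero => simp
  | tmul a b => rfl
  | add x y hx hy => simp only [map_add, hx, hy]

theorem norms_swap_le : norms (swap A) ≤ (Psi A).range := by
  rintro _ ⟨x, rfl⟩
  exact ⟨polar x, Psi_polar x⟩

/-- Up to norms, `x` is the sum of its components `(e i ⊗ e i) x`, each coming from the tensor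
square of a cyclic group, where every tensor is a multiple of `g ⊗ g`. -/
theorem mem_range_Psi_of_fg [AddGroup.FG A] {x : A ⊗[ℤ] A} (hx : swap A x = x) :
    x ∈ (Psi A).range := by
  obtain ⟨ι, _, e, he, hc⟩ := exists_sum_cyclic_eq_id A
  have h := diagonal_sum_sub_mem_norms (swap A) (swap A) tensorMap tensorMap_add_left
    tensorMap_add_right tensorMap_swap hx Finset.univ e
  rw [he, show tensorMap (AddMonoidHom.id A) (AddMonoidHom.id A) x = x from squareMap_id x] at h
  have hsum : ∑ i, tensorMap (e i) (e i) x ∈ (Psi A).range := by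
    refine sum_mem fun i _ => ?_
    have := hc i
    obtain ⟨y, hy⟩ := mem_range_Psi_of_isAddCyclic (squareMap (e i).rangeRestrict x)
    refine ⟨gammaMap (e i).range.subtype y, ?_⟩
    rw [Psi_gammaMap, hy, ← squareMap_comp]
    rfl
  have := add_mem (norms_swap_le h) hsum
  rwa [sub_add_cancel] at this

/-- Every symmetric tensor is a combination of squares. -/
theorem mem_range_Psi_of_swap_eq {x : A ⊗[ℤ] A} (hx : swap A x = x) : x ∈ (Psi A).range := by
  obtain ⟨s, y, rfl⟩ := exists_squareMap_fgSub_eq x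
  -- The lift `y` need not be symmetric; it becomes so in a larger finitely generated subgroup.
  have h0 : squareMap (fgSub s).subtype (swap _ y - y) = 0 := by
    rw [map_sub, squareMap_swap, hx, sub_self]
  obtain ⟨t, h, h1⟩ := exists_squareMap_fgIncl_eq_zero h0
  rw [map_sub, squareMap_swap, sub_eq_zero] at h1
  obtain ⟨z, hz⟩ := mem_range_Psi_of_fg h1
  refine ⟨gammaMap (fgSub t).subtype z, ?_⟩
  rw [Psi_gammaMap, hz, ← squareMap_comp]
  rfl

variable (A) in
/-- The subgroup of `Γ(A)` generated by the elements `2ⁿ γ(a)` with `2ⁿ a = 0`. -/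
def torsionGamma : AddSubgroup (Gamma A) :=
  AddSubgroup.closure {x | ∃ (n : ℕ) (a : A), (2 : ℤ) ^ n • a = 0 ∧ x = (2 : ℤ) ^ n • gamma a}

theorem gammaMap_mem_torsionGamma {B : Type u} [AddCommGroup B] (f : A →+ B) {x : Gamma A}
    (hx : x ∈ torsionGamma A) : gammaMap f x ∈ torsionGamma B := by
  have hle : torsionGamma A ≤ (torsionGamma B).comap (gammaMap f) := by
    rw [torsionGamma, AddSubgroup.closure_le]
    rintro _ ⟨n, a, h, rfl⟩
    refine AddSubgroup.subset_closure ⟨n, f a, ?_, ?_⟩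
    · rw [← map_zsmul, h, map_zero]
    · rw [map_zsmul, gammaMap_gamma]
  exact hle hx

/-- A cyclic group is the additive group of the ring `ZMod (Nat.card A)`, which is `ℤ` in the
infinite case because `Nat.card` is then `0`. Multiplication turns `k (g ⊗ g) = 0` into `k g² = 0`,
and a generator is a unit. -/
theorem zsmul_eq_zero_of_zsmul_tmul_self [IsAddCyclic A] {g : A}
    (hg : ∀ x, x ∈ AddSubgroup.zmultiples g) {k : ℤ} (h : k • (g ⊗ₜ[ℤ] g) = 0) : k • g = 0 := by
  let φ := zmodAddCyclicAddEquiv (G := A) inferInstance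
  obtain ⟨m, hm⟩ := hg (φ 1)
  have hm' : m • φ.symm g = 1 := by
    rw [← map_zsmul]
    exact (congrArg φ.symm hm).trans (φ.symm_apply_apply 1)
  let μ : A ⊗[ℤ] A →ₗ[ℤ] ZMod (Nat.card A) :=
    (LinearMap.mul' ℤ _).comp (TensorProduct.map φ.symm.toAddMonoidHom.toIntLinearMap
      φ.symm.toAddMonoidHom.toIntLinearMap)
  have h1 : k • (φ.symm g * φ.symm g) = 0 := by
    have h2 := congrArg μ h
    rw [map_zero, map_smul] at h2
    exact h2
  apply φ.symm.injective
  rw [map_zero, map_zsmul]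
  calc k • φ.symm g = k • φ.symm g * (m • φ.symm g) := by rw [hm', mul_one]
    _ = m • (k • (φ.symm g * φ.symm g)) := by
      rw [smul_mul_assoc, mul_smul_comm, smul_comm]
    _ = 0 := by rw [h1, smul_zero]

theorem mem_zmultiples_gamma {g : A} (hg : ∀ x, x ∈ AddSubgroup.zmultiples g) (x : Gamma A) :
    x ∈ AddSubgroup.zmultiples (gamma g) := by
  induction x using gamma_induction with
  | zero => exact zero_mem _
  | of a =>
    obtain ⟨k, rfl⟩ := hg a
    exact ⟨k * k, (gamma_zsmul k g).symm⟩
  | neg x hx => exact neg_mem hx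
  | add x y hx hy => exact add_mem hx hy

/-- It is the polarization of `(k a) ⊗ a`. The factor `2`, absent from `k (a ⊗ a) = 0`, is the
source of the kernel of `Ψ`. -/
theorem two_mul_zsmul_gamma {k : ℤ} {a : A} (h : k • a = 0) : (2 * k) • gamma a = 0 := by
  rw [mul_comm, mul_smul, ← polar_self, ← map_zsmul, TensorProduct.smul_tmul', h,
    TensorProduct.zero_tmul, map_zero]

/-- Here `x = k γ(g)`, and `Ψ x = 0` forces `k g = 0`. For `k = 2ⁿ m` with `m` odd, `2ⁿ γ(m g) = k m
γ(g)`. This differs from `k γ(g)` by a multiple of `2 k γ(g) = 0`, since `m - 1` is even. -/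
theorem mem_torsionGamma_of_isAddCyclic [IsAddCyclic A] {x : Gamma A} (hx : Psi A x = 0) :
    x ∈ torsionGamma A := by
  obtain ⟨g, hg⟩ := IsAddCyclic.exists_generator (α := A)
  obtain ⟨k, rfl⟩ := mem_zmultiples_gamma hg x
  change Psi A (k • gamma g) = 0 at hx
  change k • gamma g ∈ _
  rw [map_zsmul, Psi_gamma] at hx
  have hk := zsmul_eq_zero_of_zsmul_tmul_self hg hx
  rcases eq_or_ne k 0 with rfl | h0
  · rw [zero_smul]; exact zero_mem _
  obtain ⟨n, m, hm, rfl⟩ : ∃ (n : ℕ) (m : ℤ), Odd m ∧ k = 2 ^ n * m := by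
    obtain ⟨n, m, hm, h⟩ := Nat.exists_eq_two_pow_mul_odd (Int.natAbs_ne_zero.2 h0)
    have hm' : Odd (m : ℤ) := (Int.odd_coe_nat m).2 hm
    rcases Int.natAbs_eq k with h' | h'
    · exact ⟨n, m, hm', by rw [h', h]; push_cast; rfl⟩
    · exact ⟨n, -m, hm'.neg, by rw [h', h]; push_cast; ring⟩
  refine AddSubgroup.subset_closure ⟨n, m • g, by rw [smul_smul, hk], ?_⟩
  obtain ⟨l, rfl⟩ := hm
  rw [gamma_zsmul, smul_smul, ← sub_eq_zero, ← sub_smul,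
    show 2 ^ n * (2 * l + 1) - 2 ^ n * ((2 * l + 1) * (2 * l + 1)) =
      -l * (2 * (2 ^ n * (2 * l + 1))) by ring, mul_smul, two_mul_zsmul_gamma hk, smul_zero]

/-- After enlarging the finitely generated subgroup so that `Ψ` vanishes already there, additivity
on `ker Ψ` writes the element as the sum of its images under endomorphisms with cyclic ranges. -/
theorem mem_torsionGamma_of_Psi_eq_zero {x : Gamma A} (hx : Psi A x = 0) :
    x ∈ torsionGamma A := by
  obtain ⟨s, y, rfl⟩ := exists_gammaMap_fgSub_eq x
  rw [Psi_gammaMap] at hx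
  obtain ⟨t, h, h1⟩ := exists_squareMap_fgIncl_eq_zero hx
  rw [← Psi_gammaMap] at h1
  obtain ⟨ι, _, e, he, hc⟩ := exists_sum_cyclic_eq_id (fgSub t)
  have hsum := gammaMap_sum Finset.univ e h1
  rw [he, gammaMap_id] at hsum
  have hy : gammaMap (fgSub s).subtype y =
      gammaMap (fgSub t).subtype (gammaMap (fgIncl h) y) := by
    rw [← gammaMap_comp]; rfl
  rw [hy, hsum]
  refine gammaMap_mem_torsionGamma _ (sum_mem fun i _ => ?_)
  have := hc i
  have hz : gammaMap (e i) (gammaMap (fgIncl h) y) = gammaMap (e i).range.subtype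
      (gammaMap (e i).rangeRestrict (gammaMap (fgIncl h) y)) :=
    gammaMap_comp (e i).range.subtype (e i).rangeRestrict _
  rw [hz]
  refine gammaMap_mem_torsionGamma _ (mem_torsionGamma_of_isAddCyclic ?_)
  rw [Psi_gammaMap, h1, map_zero]

end Kernel

/-! ### The limit of the groups `ₙA ⊗ ₙA` -/

section TorLimit

variable {A B C : Type u} [AddCommGroup A] [AddCommGroup B] [AddCommGroup C]

variable (A) in
/-- The class `τₙ(a, b)` in the limit. -/
def torTau (n : ℕ) : tors A n →+ tors A n →+ torLim A :=
  AddMonoidHom.mk' (fun a => AddMonoidHom.mk' (fun b => toTorLim A n (a ⊗ₜ b))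
      (fun b b' => by rw [TensorProduct.tmul_add, map_add]))
    (fun a a' => AddMonoidHom.ext fun b =>
      (congrArg (toTorLim A n) (TensorProduct.add_tmul a a' b)).trans (map_add _ _ _))

theorem torTau_incl_right {k n : ℕ} (h : k ≤ n) (a : tors A n) (b : tors A k) :
    torTau A n a (torsIncl h b) = torTau A k (torsMul h a) b :=
  QuotientAddGroup.eq_iff_sub_mem.2
    (AddSubgroup.subset_closure (Or.inl ⟨k, n, h, a, b, rfl⟩))

theorem torTau_incl_left {k n : ℕ} (h : k ≤ n) (a : tors A k) (b : tors A n) :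
    torTau A n (torsIncl h a) b = torTau A k a (torsMul h b) :=
  QuotientAddGroup.eq_iff_sub_mem.2
    (AddSubgroup.subset_closure (Or.inr ⟨k, n, h, a, b, rfl⟩))

theorem torLimSwap_torTau (n : ℕ) (a b : tors A n) :
    torLimSwap A (torTau A n a b) = torTau A n b a :=
  (toTorLim_swap A n (a ⊗ₜ b)).symm

theorem torLim_induction {p : torLim A → Prop} (x : torLim A) (zero : p 0)
    (tau : ∀ n a b, p (torTau A n a b)) (add : ∀ x y, p x → p y → p (x + y)) : p x := by
  obtain ⟨y, rfl⟩ := QuotientAddGroup.mk'_surjective _ x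
  induction y using DirectSum.induction_on with
  | zero => exact zero
  | of n z =>
    refine TensorProduct.induction_on
      (motive := fun z => p (QuotientAddGroup.mk' (torRel A) (DirectSum.of (torsSq A) n z)))
      z ?_ (tau n) fun z w hz hw => ?_
    · rw [map_zero]; exact zero
    · rw [map_add, map_add]; exact add _ _ hz hw
  | add y z hy hz => rw [map_add]; exact add _ _ hy hz

theorem torLim_hom_ext {D : Type v} [AddCommGroup D] {f g : torLim A →+ D}
    (h : ∀ n a b, f (torTau A n a b) = g (torTau A n a b)) : f = g := by
  refine DFunLike.ext _ _ fun x => ?_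
  induction x using torLim_induction with
  | zero => simp
  | tau n a b => exact h n a b
  | add x y hx hy => rw [map_add, map_add, hx, hy]

/-- The homomorphism from the direct sum given by biadditive maps. -/
def torsSumLift {D : Type v} [AddCommGroup D] (β : ∀ n, tors A n →+ tors A n →+ D) :
    torsSum A →+ D :=
  DirectSum.toAddMonoid fun n => TensorProduct.liftAddHom (β n)
    (fun r a b => by rw [map_zsmul, map_zsmul, AddMonoidHom.zsmul_apply])

theorem torsSumLift_tau {D : Type v} [AddCommGroup D] (β : ∀ n, tors A n →+ tors A n →+ D)
    (n : ℕ) (a b : tors A n) : torsSumLift β (tau n a b) = β n a b := by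
  rw [torsSumLift, DirectSum.toAddMonoid_of]
  rfl

/-- The universal property of the limit. -/
def torLift {D : Type v} [AddCommGroup D] (β : ∀ n, tors A n →+ tors A n →+ D)
    (hr : ∀ (k n : ℕ) (h : k ≤ n) (a : tors A n) (b : tors A k),
      β n a (torsIncl h b) = β k (torsMul h a) b)
    (hl : ∀ (k n : ℕ) (h : k ≤ n) (a : tors A k) (b : tors A n),
      β n (torsIncl h a) b = β k a (torsMul h b)) : torLim A →+ D :=
  QuotientAddGroup.lift (torRel A) (torsSumLift β) <| by
    rw [torRel, AddSubgroup.closure_le]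
    rintro x (⟨k, n, h, a, b, rfl⟩ | ⟨k, n, h, a, b, rfl⟩)
    · rw [SetLike.mem_coe, AddMonoidHom.mem_ker, map_sub, torsSumLift_tau, torsSumLift_tau,
        sub_eq_zero]
      exact hr k n h a b
    · rw [SetLike.mem_coe, AddMonoidHom.mem_ker, map_sub, torsSumLift_tau, torsSumLift_tau,
        sub_eq_zero]
      exact hl k n h a b

theorem torLift_torTau {D : Type v} [AddCommGroup D] (β : ∀ n, tors A n →+ tors A n →+ D)
    (hr : ∀ (k n : ℕ) (h : k ≤ n) (a : tors A n) (b : tors A k),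
      β n a (torsIncl h b) = β k (torsMul h a) b)
    (hl : ∀ (k n : ℕ) (h : k ≤ n) (a : tors A k) (b : tors A n),
      β n (torsIncl h a) b = β k a (torsMul h b)) (n : ℕ) (a b : tors A n) :
    torLift β hr hl (torTau A n a b) = β n a b :=
  torsSumLift_tau β n a b

/-- The map of torsion subgroups induced by a homomorphism. -/
def torsMap (f : A →+ B) (n : ℕ) : tors A n →+ tors B n :=
  (f.comp (tors A n).subtype).codRestrict (tors B n) fun a => by
    have h : (2 : ℤ) ^ n • (a : A) = 0 := a.2
    rw [mem_tors, AddMonoidHom.comp_apply, ← map_zsmul]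
    exact (congrArg f h).trans (map_zero f)

theorem torsMap_incl (f : A →+ B) {k n : ℕ} (h : k ≤ n) (a : tors A k) :
    torsMap f n (torsIncl h a) = torsIncl h (torsMap f k a) := rfl

theorem torsMap_mul (f : A →+ B) {k n : ℕ} (h : k ≤ n) (a : tors A n) :
    torsMap f k (torsMul h a) = torsMul h (torsMap f n a) :=
  Subtype.ext (map_zsmul f _ _)

/-- The map of limits `τₙ(a, b) ↦ τₙ(f a, g b)`. -/
def torMap (f g : A →+ B) : torLim A →+ torLim B :=
  torLift (fun n => ((torTau B n).compl₂ (torsMap g n)).comp (torsMap f n))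
    (fun _ _ h a b => by
      simp only [AddMonoidHom.comp_apply, AddMonoidHom.compl₂_apply, torsMap_incl, torsMap_mul,
        torTau_incl_right])
    (fun _ _ h a b => by
      simp only [AddMonoidHom.comp_apply, AddMonoidHom.compl₂_apply, torsMap_incl, torsMap_mul,
        torTau_incl_left])

@[simp] theorem torMap_torTau (f g : A →+ B) (n : ℕ) (a b : tors A n) :
    torMap f g (torTau A n a b) = torTau B n (torsMap f n a) (torsMap g n b) :=
  torLift_torTau _ _ _ n a b

theorem torMap_comp (g : B →+ C) (f : A →+ B) (x : torLim A) :
    torMap (g.comp f) (g.comp f) x = torMap g g (torMap f f x) := by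
  refine DFunLike.congr_fun (f := torMap (g.comp f) (g.comp f))
    (g := (torMap g g).comp (torMap f f)) ?_ x
  exact torLim_hom_ext fun n a b => by
    rw [AddMonoidHom.comp_apply, torMap_torTau, torMap_torTau, torMap_torTau]
    rfl

theorem torMap_id (x : torLim A) :
    torMap (AddMonoidHom.id A) (AddMonoidHom.id A) x = x := by
  refine DFunLike.congr_fun (f := torMap (AddMonoidHom.id A) (AddMonoidHom.id A))
    (g := AddMonoidHom.id _) ?_ x
  exact torLim_hom_ext fun n a b => torMap_torTau _ _ n a b

theorem torMap_swap (f g : A →+ B) (x : torLim A) :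
    torMap g f (torLimSwap A x) = torLimSwap B (torMap f g x) := by
  refine DFunLike.congr_fun (f := (torMap g f).comp (torLimSwap A))
    (g := (torLimSwap B).comp (torMap f g)) ?_ x
  exact torLim_hom_ext fun n a b => by
    simp only [AddMonoidHom.comp_apply, torLimSwap_torTau, torMap_torTau]

theorem torMap_add_left (f f' g : A →+ B) : torMap (f + f') g = torMap f g + torMap f' g :=
  torLim_hom_ext fun n a b => by
    rw [AddMonoidHom.add_apply, torMap_torTau, torMap_torTau, torMap_torTau,
      ← AddMonoidHom.add_apply, ← map_add]
    rfl

theorem torMap_add_right (f g g' : A →+ B) : torMap f (g + g') = torMap f g + torMap f g' :=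
  torLim_hom_ext fun n a b => by
    rw [AddMonoidHom.add_apply, torMap_torTau, torMap_torTau, torMap_torTau, ← map_add]
    rfl

instance torSystem : DirectedSystem (fun s : Finset A => torLim (fgSub s))
    (fun _ _ h => torMap (fgIncl h) (fgIncl h)) where
  map_self _ x := torMap_id x
  map_map _ _ _ _ _ x := (torMap_comp _ _ x).symm

open scoped Classical in
variable (A) in
/-- The direct limit of the groups `torLim S`, `S` a finitely generated subgroup of `A`. -/
abbrev torLimLim : Type u :=
  AddCommGroup.DirectLimit (fun s : Finset A => torLim (fgSub s))
    (fun _ _ h => torMap (fgIncl h) (fgIncl h))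

open scoped Classical in
/-- The canonical map to the direct limit. -/
def torLimLimOf (s : Finset A) : torLim (fgSub s) →+ torLimLim A :=
  AddCommGroup.DirectLimit.of (fun s : Finset A => torLim (fgSub s))
    (fun _ _ h => torMap (fgIncl h) (fgIncl h)) s

theorem torLimLimOf_map {s t : Finset A} (h : s ≤ t) (x : torLim (fgSub s)) :
    torLimLimOf t (torMap (fgIncl h) (fgIncl h) x) = torLimLimOf s x := by
  classical
  exact AddCommGroup.DirectLimit.of_f (G := fun s : Finset A => torLim (fgSub s))
    (f := fun _ _ h => torMap (fgIncl h) (fgIncl h)) h x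

/-- A torsion element, as an element of a subgroup containing it. -/
def torsRestrict {n : ℕ} (a : tors A n) {s : Finset A} (h : (a : A) ∈ s) : tors (fgSub s) n :=
  ⟨⟨a, mem_fgSub h⟩, Subtype.ext a.2⟩

/-- The two representatives coincide in the subgroup generated by `r ∪ s`. Hence the class depends
only on the underlying elements of `A`. -/
theorem torLimLimOf_torTau_eq (n : ℕ) {r s : Finset A} {a b : tors (fgSub r) n}
    {a' b' : tors (fgSub s) n} (ha : ((a : fgSub r) : A) = (a' : fgSub s))
    (hb : ((b : fgSub r) : A) = (b' : fgSub s)) :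
    torLimLimOf r (torTau _ n a b) = torLimLimOf s (torTau _ n a' b') := by
  classical
  have h₁ : r ≤ r ∪ s := Finset.subset_union_left
  have h₂ : s ≤ r ∪ s := Finset.subset_union_right
  have ha' : torsMap (fgIncl h₁) n a = torsMap (fgIncl h₂) n a' :=
    Subtype.ext (Subtype.ext ha)
  have hb' : torsMap (fgIncl h₁) n b = torsMap (fgIncl h₂) n b' :=
    Subtype.ext (Subtype.ext hb)
  rw [← torLimLimOf_map h₁, ← torLimLimOf_map h₂, torMap_torTau, torMap_torTau, ha', hb']

open scoped Classical in
/-- The class of `τₙ(a, b)` in the direct limit. -/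
def torLimLimTau (n : ℕ) (a b : tors A n) : torLimLim A :=
  torLimLimOf {(a : A), (b : A)}
    (torTau _ n (torsRestrict a (by simp)) (torsRestrict b (by simp)))

theorem torLimLimTau_eq (n : ℕ) {s : Finset A} (a b : tors (fgSub s) n) :
    torLimLimTau n (torsMap (fgSub s).subtype n a) (torsMap (fgSub s).subtype n b) =
      torLimLimOf s (torTau _ n a b) := by
  rw [torLimLimTau]
  exact torLimLimOf_torTau_eq n rfl rfl

theorem torLimLimTau_add_right (n : ℕ) (a b b' : tors A n) :
    torLimLimTau n a (b + b') = torLimLimTau n a b + torLimLimTau n a b' := by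
  classical
  let s : Finset A := {(a : A), (b : A), (b' : A)}
  let a₀ : tors (fgSub s) n := torsRestrict a (by simp [s])
  let b₀ : tors (fgSub s) n := torsRestrict b (by simp [s])
  let c₀ : tors (fgSub s) n := torsRestrict b' (by simp [s])
  have h := torLimLimTau_eq n a₀ (b₀ + c₀)
  rw [map_add, map_add, map_add, ← torLimLimTau_eq, ← torLimLimTau_eq] at h
  exact h

theorem torLimLimTau_add_left (n : ℕ) (a a' b : tors A n) :
    torLimLimTau n (a + a') b = torLimLimTau n a b + torLimLimTau n a' b := by
  classical
  let s : Finset A := {(a : A), (a' : A), (b : A)}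
  let a₀ : tors (fgSub s) n := torsRestrict a (by simp [s])
  let c₀ : tors (fgSub s) n := torsRestrict a' (by simp [s])
  let b₀ : tors (fgSub s) n := torsRestrict b (by simp [s])
  have h := torLimLimTau_eq n (a₀ + c₀) b₀
  rw [map_add (torTau _ n), AddMonoidHom.add_apply, map_add, map_add, ← torLimLimTau_eq,
    ← torLimLimTau_eq] at h
  exact h

/-- The map to the direct limit over the finitely generated subgroups. -/
def toTorLimLim : torLim A →+ torLimLim A :=
  torLift (fun n => AddMonoidHom.mk' (fun a => AddMonoidHom.mk' (torLimLimTau n a)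
      (torLimLimTau_add_right n a))
      (fun a a' => AddMonoidHom.ext (torLimLimTau_add_left n a a')))
    (fun k n h a b => by
      classical
      let s : Finset A := {(a : A), (b : A)}
      let a₀ : tors (fgSub s) n := torsRestrict a (by simp [s])
      let b₀ : tors (fgSub s) k := torsRestrict b (by simp [s])
      refine (torLimLimTau_eq n a₀ (torsIncl h b₀)).trans ?_
      rw [torTau_incl_right]
      exact (torLimLimTau_eq k (torsMul h a₀) b₀).symm)
    (fun k n h a b => by
      classical
      let s : Finset A := {(a : A), (b : A)}
      let a₀ : tors (fgSub s) k := torsRestrict a (by simp [s])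
      let b₀ : tors (fgSub s) n := torsRestrict b (by simp [s])
      refine (torLimLimTau_eq n (torsIncl h a₀) b₀).trans ?_
      rw [torTau_incl_left]
      exact (torLimLimTau_eq k a₀ (torsMul h b₀)).symm)

theorem toTorLimLim_map {s : Finset A} (x : torLim (fgSub s)) :
    toTorLimLim (torMap (fgSub s).subtype (fgSub s).subtype x) = torLimLimOf s x := by
  refine DFunLike.congr_fun (f := toTorLimLim.comp (torMap (fgSub s).subtype (fgSub s).subtype))
    (g := torLimLimOf s) ?_ x
  exact torLim_hom_ext fun n a b => by
    rw [AddMonoidHom.comp_apply, torMap_torTau, ← torLimLimTau_eq]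
    exact torLift_torTau _ _ _ n _ _

/-- As for tensor squares, the map to the direct limit over finitely generated subgroups factors
through `torLim A`. -/
theorem exists_torMap_fgIncl_eq_zero {s : Finset A} {x : torLim (fgSub s)}
    (hx : torMap (fgSub s).subtype (fgSub s).subtype x = 0) :
    ∃ (t : Finset A) (h : s ≤ t), torMap (fgIncl h) (fgIncl h) x = 0 := by
  classical
  have h : torLimLimOf s x = 0 := by rw [← toTorLimLim_map, hx, map_zero]
  exact AddCommGroup.DirectLimit.of.zero_exact
    (G := fun s : Finset A => torLim (fgSub s))
    (f := fun _ _ h => torMap (fgIncl h) (fgIncl h)) s x h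

theorem exists_torMap_fgSub_eq (x : torLim A) :
    ∃ (s : Finset A) (y : torLim (fgSub s)),
      torMap (fgSub s).subtype (fgSub s).subtype y = x := by
  classical
  induction x using torLim_induction with
  | zero => exact ⟨∅, 0, map_zero _⟩
  | tau n a b =>
    exact ⟨{(a : A), (b : A)},
      torTau _ n (torsRestrict a (by simp)) (torsRestrict b (by simp)), torMap_torTau _ _ _ _ _⟩
  | add x y hx hy =>
    obtain ⟨s, x, rfl⟩ := hx
    obtain ⟨t, y, rfl⟩ := hy
    refine ⟨s ∪ t, torMap (fgIncl Finset.subset_union_left) (fgIncl Finset.subset_union_left) x +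
      torMap (fgIncl Finset.subset_union_right) (fgIncl Finset.subset_union_right) y, ?_⟩
    rw [map_add, ← torMap_comp, ← torMap_comp]
    rfl

variable (A) in
/-- The subgroup of the limit generated by the elements `τₙ(a, a)`. -/
def torDiagonal : AddSubgroup (torLim A) :=
  AddSubgroup.closure {x | ∃ (n : ℕ) (a : tors A n), x = torTau A n a a}

theorem torTau_self_mem (n : ℕ) (a : tors A n) : torTau A n a a ∈ torDiagonal A :=
  AddSubgroup.subset_closure ⟨n, a, rfl⟩

theorem norms_torLimSwap_le : norms (torLimSwap A) ≤ torDiagonal A := by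
  rintro _ ⟨x, rfl⟩
  induction x using torLim_induction with
  | zero => rw [map_zero]; exact zero_mem _
  | tau n a b =>
    have h := sub_mem (sub_mem (torTau_self_mem n (a + b)) (torTau_self_mem n a))
      (torTau_self_mem n b)
    rw [AddMonoidHom.add_apply, AddMonoidHom.id_apply, torLimSwap_torTau]
    convert h using 1
    simp only [map_add, AddMonoidHom.add_apply]
    abel
  | add x y hx hy => rw [map_add]; exact add_mem hx hy

theorem torMap_mem_torDiagonal (f : A →+ B) {x : torLim A} (hx : x ∈ torDiagonal A) :
    torMap f f x ∈ torDiagonal B := by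
  have hle : torDiagonal A ≤ (torDiagonal B).comap (torMap f f) := by
    rw [torDiagonal, AddSubgroup.closure_le]
    rintro _ ⟨n, a, rfl⟩
    exact AddSubgroup.subset_closure ⟨n, torsMap f n a, torMap_torTau _ _ _ _ _⟩
  exact hle hx

/-- The `2ⁿ`-torsion is cyclic as well, so `τₙ(a, b)` is a multiple of `τₙ(g, g)`. -/
theorem mem_torDiagonal_of_isAddCyclic [IsAddCyclic A] (x : torLim A) : x ∈ torDiagonal A := by
  induction x using torLim_induction with
  | zero => exact zero_mem _
  | tau n a b =>
    obtain ⟨g, hg⟩ := IsAddCyclic.exists_generator (α := tors A n)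
    obtain ⟨k, rfl⟩ := hg a
    obtain ⟨l, rfl⟩ := hg b
    have h := zsmul_mem (zsmul_mem (torTau_self_mem n g) l) k
    rw [← map_zsmul, ← AddMonoidHom.zsmul_apply, ← map_zsmul] at h
    exact h
  | add x y hx hy => exact add_mem hx hy

/-- The argument for symmetric tensors applies because `torMap` is biadditive and compatible with
the interchange, and norms are diagonal by polarization. -/
theorem mem_torDiagonal_of_fg [AddGroup.FG A] {x : torLim A} (hx : torLimSwap A x = x) :
    x ∈ torDiagonal A := by
  obtain ⟨ι, _, e, he, hc⟩ := exists_sum_cyclic_eq_id A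
  have h := diagonal_sum_sub_mem_norms (torLimSwap A) (torLimSwap A) torMap torMap_add_left
    torMap_add_right torMap_swap hx Finset.univ e
  rw [he, torMap_id] at h
  have hsum : ∑ i, torMap (e i) (e i) x ∈ torDiagonal A := by
    refine sum_mem fun i _ => ?_
    have := hc i
    have h := torMap_mem_torDiagonal (e i).range.subtype
      (mem_torDiagonal_of_isAddCyclic (torMap (e i).rangeRestrict (e i).rangeRestrict x))
    rw [← torMap_comp] at h
    exact h
  have := add_mem (norms_torLimSwap_le h) hsum
  rwa [sub_add_cancel] at this

/-- The symmetric elements of the limit are generated by the elements `τₙ(a, a)`. -/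
theorem mem_torDiagonal_of_swap_eq {x : torLim A} (hx : torLimSwap A x = x) :
    x ∈ torDiagonal A := by
  obtain ⟨s, y, rfl⟩ := exists_torMap_fgSub_eq x
  have h0 : torMap (fgSub s).subtype (fgSub s).subtype (torLimSwap _ y - y) = 0 := by
    rw [map_sub, torMap_swap, hx, sub_self]
  obtain ⟨t, h, h1⟩ := exists_torMap_fgIncl_eq_zero h0
  rw [map_sub, torMap_swap, sub_eq_zero] at h1
  have h2 := torMap_mem_torDiagonal (fgSub t).subtype (mem_torDiagonal_of_fg h1)
  rw [← torMap_comp] at h2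
  exact h2

end TorLimit

/-! ### Characters with values in `ℤ/N` -/

section Characters

/-- The embedding of `ℤ/N` in `ℚ/ℤ`. -/
theorem exists_zmod_hom_addCircle (N : ℕ) [NeZero N] :
    ∃ j : ZMod N →+ AddCircle (1 : ℚ), Function.Injective j ∧
      ∀ r : AddCircle (1 : ℚ), N • r = 0 → r ∈ j.range := by
  have hN : (N : ℚ) ≠ 0 := Nat.cast_ne_zero.2 (NeZero.ne N)
  let c : AddCircle (1 : ℚ) := ((1 / N : ℚ) : AddCircle (1 : ℚ))
  have hc : zmultiplesHom (AddCircle (1 : ℚ)) c N = 0 := by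
    rw [zmultiplesHom_apply]
    change (N : ℤ) • ((1 / N : ℚ) : AddCircle (1 : ℚ)) = 0
    rw [← AddCircle.coe_zsmul, AddCircle.coe_eq_zero_iff]
    exact ⟨1, by simp [hN]⟩
  have hj : ∀ k : ℤ, ZMod.lift N ⟨zmultiplesHom (AddCircle (1 : ℚ)) c, hc⟩ k =
      ((k / N : ℚ) : AddCircle (1 : ℚ)) := by
    intro k
    rw [ZMod.lift_coe, zmultiplesHom_apply]
    change k • ((1 / N : ℚ) : AddCircle (1 : ℚ)) = _
    rw [← AddCircle.coe_zsmul, zsmul_eq_mul, mul_one_div]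
  refine ⟨ZMod.lift N ⟨zmultiplesHom _ c, hc⟩, (injective_iff_map_eq_zero _).2 ?_, ?_⟩
  · intro z hz
    obtain ⟨k, rfl⟩ := ZMod.intCast_surjective z
    rw [hj, AddCircle.coe_eq_zero_iff] at hz
    obtain ⟨l, hl⟩ := hz
    rw [zsmul_eq_mul, mul_one, eq_div_iff hN] at hl
    rw [ZMod.intCast_zmod_eq_zero_iff_dvd]
    exact ⟨l, by exact_mod_cast (hl.symm.trans (mul_comm _ _))⟩
  · intro r hr
    obtain ⟨q, rfl⟩ := QuotientAddGroup.mk_surjective r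
    change N • (q : AddCircle (1 : ℚ)) = 0 at hr
    rw [← AddCircle.coe_nsmul, AddCircle.coe_eq_zero_iff] at hr
    obtain ⟨k, hk⟩ := hr
    rw [zsmul_eq_mul, mul_one, nsmul_eq_mul] at hk
    refine ⟨k, (hj k).trans ?_⟩
    rw [hk, mul_div_cancel_left₀ _ hN]

/-- An element which is not divisible by `N` is detected by a homomorphism to `ℤ/N`. -/
theorem exists_zmod_hom_ne_zero {A : Type u} [AddCommGroup A] (N : ℕ) [NeZero N] {z : A}
    (hz : ∀ y : A, z ≠ N • y) : ∃ χ : A →+ ZMod N, χ z ≠ 0 := by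
  let K : AddSubgroup A := (nsmulAddMonoidHom N : A →+ A).range
  have hz' : (z : A ⧸ K) ≠ 0 := by
    intro h
    obtain ⟨y, hy⟩ := (QuotientAddGroup.eq_zero_iff z).1 h
    exact hz y hy.symm
  obtain ⟨c, hc⟩ := CharacterModule.exists_character_apply_ne_zero_of_ne_zero hz'
  obtain ⟨j, hj, hr⟩ := exists_zmod_hom_addCircle N
  let c' : A →+ AddCircle (1 : ℚ) := AddMonoidHom.comp (c : (A ⧸ K) →+ AddCircle (1 : ℚ))
    (QuotientAddGroup.mk' K)
  -- The character kills `N A`, so its values are killed by `N`.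
  have hmem : ∀ a, c' a ∈ j.range := fun a => hr _ <| by
    have h0 : QuotientAddGroup.mk' K (N • a) = 0 := (QuotientAddGroup.eq_zero_iff _).2 ⟨a, rfl⟩
    rw [← map_nsmul]
    exact (congrArg c h0).trans (map_zero c)
  let e : ZMod N ≃+ j.range := AddMonoidHom.ofInjective hj
  refine ⟨e.symm.toAddMonoidHom.comp (c'.codRestrict j.range hmem), fun h => hc ?_⟩
  have h1 : c'.codRestrict j.range hmem z = 0 := e.symm.injective (h.trans (map_zero _).symm)
  exact congrArg Subtype.val h1

/-- `(u + N c)² = u² + 2 N u c + N² c²`, and `2 N` divides `N²` for even `N`. Squaring thus gains a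
factor `2` in the modulus. -/
theorem sq_cast_eq_of_cast_eq {N : ℕ} (hN : Even N) {u v : ℤ} (h : (u : ZMod N) = v) :
    ((u ^ 2 : ℤ) : ZMod (2 * N)) = ((v ^ 2 : ℤ) : ZMod (2 * N)) := by
  obtain ⟨M, rfl⟩ := hN
  rw [ZMod.intCast_eq_intCast_iff_dvd_sub] at h
  obtain ⟨c, hc⟩ := h
  rw [ZMod.intCast_eq_intCast_iff_dvd_sub]
  refine ⟨c * (u + M * c), ?_⟩
  obtain rfl : v = u + (M + M : ℕ) * c := by rw [← hc]; ring
  push_cast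
  ring

variable {A : Type u} [AddCommGroup A]

/-- The square of a homomorphism to `ℤ/N`, `N` even, as a quadratic map to `ℤ/2N`. -/
def sqFun {N : ℕ} (χ : A →+ ZMod N) (a : A) : ZMod (2 * N) :=
  (((χ a).cast : ℤ) ^ 2 : ℤ)

theorem sqFun_eq {N : ℕ} (hN : Even N) (χ : A →+ ZMod N) {a : A} {u : ℤ} (h : χ a = u) :
    sqFun χ a = ((u ^ 2 : ℤ) : ZMod (2 * N)) :=
  sq_cast_eq_of_cast_eq hN (by rw [ZMod.intCast_zmod_cast, h])

theorem isQuadratic_sqFun {N : ℕ} (hN : Even N) (χ : A →+ ZMod N) : IsQuadratic (sqFun χ) where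
  map_neg a := by
    obtain ⟨u, hu⟩ := ZMod.intCast_surjective (χ a)
    rw [sqFun_eq hN χ hu.symm, sqFun_eq hN χ (u := -u) (by rw [map_neg, ← hu]; push_cast; rfl),
      neg_sq]
  add_left a b c := by
    obtain ⟨u, hu⟩ := ZMod.intCast_surjective (χ a)
    obtain ⟨v, hv⟩ := ZMod.intCast_surjective (χ b)
    obtain ⟨w, hw⟩ := ZMod.intCast_surjective (χ c)
    have add : ∀ {x y : A} {p q : ℤ}, (p : ZMod N) = χ x → (q : ZMod N) = χ y →
        ((p + q : ℤ) : ZMod N) = χ (x + y) := fun h h' => by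
      rw [Int.cast_add, h, h', map_add]
    rw [sqFun_eq hN χ hu.symm, sqFun_eq hN χ hv.symm, sqFun_eq hN χ hw.symm,
      sqFun_eq hN χ (add hu hv).symm, sqFun_eq hN χ (add hu hw).symm,
      sqFun_eq hN χ (add hv hw).symm, sqFun_eq hN χ (add (add hu hv) hw).symm]
    push_cast
    ring
  add_right a b c := by
    obtain ⟨u, hu⟩ := ZMod.intCast_surjective (χ a)
    obtain ⟨v, hv⟩ := ZMod.intCast_surjective (χ b)
    obtain ⟨w, hw⟩ := ZMod.intCast_surjective (χ c)
    have add : ∀ {x y : A} {p q : ℤ}, (p : ZMod N) = χ x → (q : ZMod N) = χ y →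
        ((p + q : ℤ) : ZMod N) = χ (x + y) := fun h h' => by
      rw [Int.cast_add, h, h', map_add]
    rw [sqFun_eq hN χ hu.symm, sqFun_eq hN χ hv.symm, sqFun_eq hN χ hw.symm,
      sqFun_eq hN χ (add hu hv).symm, sqFun_eq hN χ (add hu hw).symm,
      sqFun_eq hN χ (add hv hw).symm, sqFun_eq hN χ (add hu (add hv hw)).symm]
    push_cast
    ring

end Characters

/-! ### The graded pieces of the `2`-torsion -/

section Graded

variable (A : Type u) [AddCommGroup A]

/-- The elements `x` killed by `2ⁿ⁺¹` for which `2ⁿ x` is divisible by `2ⁿ⁺¹`. -/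
def grSub (n : ℕ) : AddSubgroup (tors A (n + 1)) where
  carrier := {x | ∃ y : A, (2 : ℤ) ^ (n + 1) • y = (2 : ℤ) ^ n • (x : A)}
  zero_mem' := ⟨0, by simp⟩
  add_mem' := by
    rintro x x' ⟨y, hy⟩ ⟨y', hy'⟩
    exact ⟨y + y', by rw [smul_add, hy, hy', AddSubgroup.coe_add, smul_add]⟩
  neg_mem' := by
    rintro x ⟨y, hy⟩
    exact ⟨-y, by rw [smul_neg, hy, AddSubgroup.coe_neg, smul_neg]⟩

/-- The graded piece, isomorphic to a group of Ulm invariants of `A`. -/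
abbrev gr (n : ℕ) : Type u := tors A (n + 1) ⧸ grSub A n

variable {A}

theorem torsIncl_mem_grSub {n k : ℕ} (h : k ≤ n) (h' : k ≤ n + 1) (a : tors A k) :
    torsIncl h' a ∈ grSub A n :=
  ⟨0, by rw [smul_zero]; exact (mem_tors.1 (tors_mono h a.2)).symm⟩

theorem torsMul_mem_grSub {n m : ℕ} (h : n + 1 < m) (a : tors A m) :
    torsMul h.le a ∈ grSub A n := by
  refine ⟨(2 : ℤ) ^ (m - (n + 1) - 1) • (a : A), ?_⟩
  change _ = (2 : ℤ) ^ n • (2 : ℤ) ^ (m - (n + 1)) • (a : A)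
  rw [smul_smul, smul_smul, ← pow_add, ← pow_add]
  congr 2
  omega

/-- An element of `grSub` is the sum of an element killed by `2ⁿ` and the double of an element
killed by `2ⁿ⁺²`. -/
theorem exists_decomposition {n : ℕ} {x : tors A (n + 1)} (hx : x ∈ grSub A n) :
    ∃ (u : tors A n) (y : tors A (n + 2)),
      x = torsIncl n.le_succ u + torsMul (n + 1).le_succ y := by
  obtain ⟨y, hy⟩ := hx
  have hx' : (2 : ℤ) ^ (n + 1) • (x : A) = 0 := x.2
  refine ⟨⟨(x : A) - (2 : ℤ) • y, ?_⟩, ⟨y, ?_⟩, ?_⟩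
  · rw [mem_tors, smul_sub, smul_smul, ← pow_succ, hy, sub_self]
  · rw [mem_tors, pow_succ', mul_smul, hy, smul_smul, ← pow_succ', hx']
  · refine Subtype.ext ?_
    change (x : A) = (x : A) - (2 : ℤ) • y + (2 : ℤ) ^ (n + 2 - (n + 1)) • y
    rw [show n + 2 - (n + 1) = 1 by omega, pow_one, sub_add_cancel]

theorem eq_zero_of_tors_zero (a : tors A 0) : a = 0 := by
  refine Subtype.ext ?_
  have h : (2 : ℤ) ^ 0 • (a : A) = 0 := a.2
  rwa [pow_zero, one_smul] at h

/-- Homomorphisms out of a direct sum are injective when they are separated by functionals. -/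
theorem toAddMonoid_injective {G : ℕ → Type u} [∀ n, AddCommGroup (G n)] {D : Type u}
    [AddCommGroup D] (φ : ∀ n, G n →+ D)
    (h : ∀ n (g : G n), g ≠ 0 → ∃ (E : Type) (_ : AddCommGroup E) (q : D →+ E),
      (∀ m, m ≠ n → ∀ x, q (φ m x) = 0) ∧ q (φ n g) ≠ 0) :
    Function.Injective (DirectSum.toAddMonoid φ) := by
  refine (injective_iff_map_eq_zero _).2 fun g hg => ?_
  by_contra hne
  obtain ⟨n, hn⟩ : ∃ n, g n ≠ 0 := by
    by_contra hall
    push Not at hall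
    exact hne (DFinsupp.ext hall)
  obtain ⟨E, _, q, hq, hqn⟩ := h n (g n) hn
  have key : ∀ g : ⨁ n, G n, q (DirectSum.toAddMonoid φ g) = q (φ n (g n)) := by
    intro g
    induction g using DirectSum.induction_on with
    | zero => simp
    | of m x =>
      rw [DirectSum.toAddMonoid_of]
      rcases eq_or_ne m n with rfl | hm
      · rw [DirectSum.of_eq_same]
      · rw [hq m hm, DirectSum.of_eq_of_ne _ _ _ hm.symm, map_zero, map_zero]
    | add x y hx hy => rw [map_add, map_add, hx, hy, DirectSum.add_apply, map_add, map_add]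
  rw [← key, hg, map_zero] at hqn
  exact hqn rfl

/-! ### The kernel of `Ψ` -/

/-- The homomorphism `a ↦ 2ᵐ γ(a)` on the elements killed by `2ᵐ`. -/
def torsGamma (m : ℕ) : tors A m →+ Gamma A :=
  AddMonoidHom.mk' (fun a => (2 : ℤ) ^ m • gamma (a : A)) fun a b => by
    have h : (2 : ℤ) ^ m • (a : A) = 0 := a.2
    rw [AddSubgroup.coe_add, gamma_add, smul_add, smul_add, ← map_zsmul,
      TensorProduct.smul_tmul', h, TensorProduct.zero_tmul, map_zero, add_zero]

theorem torsGamma_apply (m : ℕ) (a : tors A m) :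
    torsGamma m a = (2 : ℤ) ^ m • gamma (a : A) := rfl

/-- The homomorphism `x ↦ 2ⁿ⁺¹ γ(x)` on a graded piece. -/
def grGamma (n : ℕ) : gr A n →+ Gamma A :=
  QuotientAddGroup.lift (grSub A n) (torsGamma (n + 1)) <| by
    intro x hx
    obtain ⟨u, y, rfl⟩ := exists_decomposition hx
    have hu : (2 : ℤ) ^ n • (u : A) = 0 := u.2
    have hy : (2 : ℤ) ^ (n + 2) • (y : A) = 0 := y.2
    rw [AddMonoidHom.mem_ker, map_add]
    -- Both terms vanish by `2 k γ(a) = 0` for `k a = 0`: the first has `k = 2ⁿ`, and the second is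
    -- `2ⁿ⁺¹ γ(2y) = 2 · 2ⁿ⁺² γ(y)`.
    have h1 : torsGamma (n + 1) (torsIncl n.le_succ u) = 0 := by
      rw [torsGamma_apply, pow_succ']
      exact two_mul_zsmul_gamma hu
    have h2 : torsGamma (n + 1) (torsMul (n + 1).le_succ y) = 0 := by
      rw [torsGamma_apply]
      change (2 : ℤ) ^ (n + 1) • gamma ((2 : ℤ) ^ (n + 2 - (n + 1)) • (y : A)) = 0
      rw [show n + 2 - (n + 1) = 1 by omega, gamma_zsmul, smul_smul,
        show (2 : ℤ) ^ (n + 1) * (2 ^ 1 * 2 ^ 1) = 2 * 2 ^ (n + 2) by ring]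
      exact two_mul_zsmul_gamma hy
    rw [h1, h2, add_zero]

theorem grGamma_mk (n : ℕ) (x : tors A (n + 1)) :
    grGamma (A := A) n (QuotientAddGroup.mk x) = (2 : ℤ) ^ (n + 1) • gamma (x : A) := rfl

variable (A) in
/-- The map from the sum of the graded pieces to `Γ(A)`. -/
def sumGamma : (⨁ n, gr A n) →+ Gamma A := DirectSum.toAddMonoid (grGamma (A := A))

/-- The generators `2ⁿ γ(a)` of `ker Ψ` come from the pieces of index `n - 1`; for `n = 0` they are
zero. -/
theorem sumGamma_exact : Function.Exact (sumGamma A) (Psi A) := by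
  intro x
  constructor
  · intro hx
    have hle : torsionGamma A ≤ (sumGamma A).range := by
      rw [torsionGamma, AddSubgroup.closure_le]
      rintro _ ⟨n, a, h, rfl⟩
      cases n with
      | zero =>
        rw [pow_zero, one_smul] at h
        rw [h, gamma_zero, smul_zero]
        exact zero_mem _
      | succ n =>
        refine ⟨DirectSum.of (gr A) n (QuotientAddGroup.mk ⟨a, h⟩), ?_⟩
        rw [sumGamma, DirectSum.toAddMonoid_of]
        rfl
    exact hle (mem_torsionGamma_of_Psi_eq_zero hx)
  · rintro ⟨g, rfl⟩
    induction g using DirectSum.induction_on with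
    | zero => simp
    | of n z =>
      obtain ⟨a, rfl⟩ := QuotientAddGroup.mk_surjective z
      have h : (2 : ℤ) ^ (n + 1) • (a : A) = 0 := a.2
      rw [sumGamma, DirectSum.toAddMonoid_of, grGamma_mk, map_zsmul, Psi_gamma,
        TensorProduct.smul_tmul', h, TensorProduct.zero_tmul]
    | add y z hy hz => rw [map_add, map_add, hy, hz, add_zero]

/-- If `x` is nonzero in `gr A n`, then `2ⁿ x` is not in `2ⁿ⁺¹ A`, so some `χ : A → ℤ/2ⁿ⁺¹` has
`χ(2ⁿ x) ≠ 0`, which means that `χ(x)` is odd. The quadratic map `χ²` to `ℤ/2ⁿ⁺²` sends `2ᵐ⁺¹ γ(a)`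
to `2ᵐ⁺¹ u²`, where `u` lifts `χ(a)`. For `m > n` this is zero by the power of `2` in front. For `m
< n` it is zero because `2ᵐ⁺¹ a = 0` makes `u` divisible by `2ⁿ⁻ᵐ`. For `m = n` and `a = x` it is
nonzero because `u` is odd. -/
theorem sumGamma_injective : Function.Injective (sumGamma A) := by
  refine toAddMonoid_injective _ fun n g hg => ?_
  obtain ⟨x, rfl⟩ := QuotientAddGroup.mk_surjective g
  have hx : ∀ y : A, (2 : ℤ) ^ n • (x : A) ≠ (2 ^ (n + 1) : ℕ) • y := fun y hy =>
    hg ((QuotientAddGroup.eq_zero_iff _).2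
      ⟨y, by rw [hy, ← natCast_zsmul]; push_cast; rfl⟩)
  obtain ⟨χ, hχ⟩ := exists_zmod_hom_ne_zero (2 ^ (n + 1)) hx
  have hN : Even (2 ^ (n + 1)) := ⟨2 ^ n, by ring⟩
  have hq : ∀ (m : ℕ) (a : A) (u : ℤ), χ a = u →
      gammaLift (sqFun χ) (isQuadratic_sqFun hN χ) ((2 : ℤ) ^ (m + 1) • gamma a) =
        ((2 ^ (m + 1) * u ^ 2 : ℤ) : ZMod (2 * 2 ^ (n + 1))) := by
    intro m a u hu
    rw [map_zsmul, gammaLift_gamma, sqFun_eq hN χ hu, zsmul_eq_mul]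
    push_cast
    rfl
  refine ⟨ZMod (2 * 2 ^ (n + 1)), inferInstance, gammaLift (sqFun χ) (isQuadratic_sqFun hN χ),
    fun m hm z => ?_, ?_⟩
  · obtain ⟨a, rfl⟩ := QuotientAddGroup.mk_surjective z
    obtain ⟨u, hu⟩ := ZMod.intCast_surjective (χ (a : A))
    have h : (2 : ℤ) ^ (m + 1) • (a : A) = 0 := a.2
    have h' : ((2 ^ (m + 1) * u : ℤ) : ZMod (2 ^ (n + 1))) = 0 := by
      have := congrArg χ h
      rw [map_zsmul, map_zero, ← hu, zsmul_eq_mul] at this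
      push_cast at this ⊢
      exact this
    rw [ZMod.intCast_zmod_eq_zero_iff_dvd] at h'
    push_cast at h'
    rw [grGamma_mk, hq m a u hu.symm, ZMod.intCast_zmod_eq_zero_iff_dvd]
    push_cast
    rcases lt_or_gt_of_ne hm with hlt | hgt
    · obtain ⟨k, rfl⟩ : ∃ k, n = m + 1 + k := ⟨n - (m + 1), by omega⟩
      obtain ⟨c, hc⟩ := h'
      have hu' : u = 2 ^ (k + 1) * c := by
        refine mul_left_cancel₀ (pow_ne_zero (m + 1) (two_ne_zero : (2 : ℤ) ≠ 0)) ?_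
        rw [hc]; ring
      exact ⟨2 ^ k * c ^ 2, by rw [hu']; ring⟩
    · obtain ⟨k, rfl⟩ : ∃ k, m = n + 1 + k := ⟨m - (n + 1), by omega⟩
      exact ⟨2 ^ k * u ^ 2, by ring⟩
  · obtain ⟨u, hu⟩ := ZMod.intCast_surjective (χ (x : A))
    rw [grGamma_mk, hq n x u hu.symm, Ne, ZMod.intCast_zmod_eq_zero_iff_dvd]
    push_cast
    rintro h
    have h2 : (2 : ℤ) ∣ u ^ 2 := by
      rw [mul_comm 2] at h
      exact (mul_dvd_mul_iff_left (pow_ne_zero (n + 1) (two_ne_zero : (2 : ℤ) ≠ 0))).1 h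
    obtain ⟨c, rfl⟩ := Int.prime_two.dvd_of_dvd_pow h2
    apply hχ
    rw [map_zsmul, ← hu, zsmul_eq_mul]
    have h3 : ((2 ^ n * (2 * c) : ℤ) : ZMod (2 ^ (n + 1))) = 0 := by
      rw [ZMod.intCast_zmod_eq_zero_iff_dvd]
      exact ⟨c, by push_cast; ring⟩
    push_cast at h3 ⊢
    exact h3

end Graded

/-! ### Diagonal classes in `H₁(Σ₂, M)` -/

section Diagonal

variable {M : Type u} [AddCommGroup M] (s : M →+ M) (hs : ∀ x, s (s x) = x)
  {B : Type u} [AddCommGroup B]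

/-- The homomorphism `H₁(Σ₂, M) → D` given by a map on fixed elements vanishing on norms. -/
def H1desc {D : Type v} [AddCommGroup D] (f : fixedPoints s →+ D)
    (hf : ∀ x : fixedPoints s, x.1 ∈ norms s → f x = 0) : H1 s hs →+ D :=
  (H1mk s hs).liftOfSurjective (H1mk_surjective s hs)
    ⟨f, fun x hx => hf x ((H1mk_eq_zero_iff s hs x).1 hx)⟩

theorem H1desc_H1mk {D : Type v} [AddCommGroup D] (f : fixedPoints s →+ D)
    (hf : ∀ x : fixedPoints s, x.1 ∈ norms s → f x = 0) (x : fixedPoints s) :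
    H1desc s hs f hf (H1mk s hs x) = f x :=
  AddMonoidHom.liftOfRightInverse_comp_apply _ _ _ _ x

variable {s}

/-- The homomorphism `b ↦ [β(b, b)]` defined by a symmetric biadditive map. -/
def H1diag (β : B →+ B →+ M) (hβ : ∀ a b, s (β a b) = β b a) : B →+ H1 s hs :=
  AddMonoidHom.mk' (fun b => H1mk s hs ⟨β b b, hβ b b⟩) fun a b => by
    rw [← map_add, ← sub_eq_zero, ← map_sub, H1mk_eq_zero_iff]
    refine ⟨β a b, ?_⟩
    rw [AddMonoidHom.add_apply, AddMonoidHom.id_apply, hβ]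
    simp only [AddSubgroup.coe_sub, AddSubgroup.coe_add, map_add, AddMonoidHom.add_apply]
    abel

theorem H1mk_eq_zero_of_eq_two {x : fixedPoints s} {w : M} (hw : s w = w) (h : x.1 = w + w) :
    H1mk s hs x = 0 :=
  (H1mk_eq_zero_iff s hs x).2 ⟨w, by rw [h, AddMonoidHom.add_apply, hw]; rfl⟩

variable (B) in
/-- The homomorphism `B → H₁(Σ₂, B ⊗ B)`, `b ↦ [b ⊗ b]`. -/
def squareClass : B →+ H1Square B :=
  H1diag (swap_swap B)
    (AddMonoidHom.mk' (fun a => AddMonoidHom.mk' (fun b => a ⊗ₜ[ℤ] b)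
        (TensorProduct.tmul_add a))
      (fun a a' => AddMonoidHom.ext (TensorProduct.add_tmul a a')))
    (fun _ _ => rfl)

theorem squareClass_apply (b : B) : squareClass B b = H1mk (swap B) (swap_swap B) ⟨b ⊗ₜ b, rfl⟩ :=
  rfl

/-- Fixed tensors are combinations of squares, and `b ↦ [b ⊗ b]` is additive modulo norms, so each
combination has the class of a single square. -/
theorem squareClass_surjective : Function.Surjective (squareClass B) := by
  intro y
  obtain ⟨⟨x, hx⟩, rfl⟩ := H1mk_surjective _ _ y
  obtain ⟨z, rfl⟩ := mem_range_Psi_of_swap_eq hx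
  have hK : ∀ z : Gamma B, ∃ b, squareClass B b =
      H1mk (swap B) (swap_swap B) ⟨Psi B z, swap_Psi z⟩ := by
    intro z
    induction z using gamma_induction with
    | zero =>
      refine ⟨0, ?_⟩
      rw [map_zero, ← map_zero (H1mk (swap B) (swap_swap B))]
      exact congrArg _ (Subtype.ext (map_zero (Psi B)).symm)
    | of a =>
      refine ⟨a, ?_⟩
      rw [squareClass_apply]
      exact congrArg _ (Subtype.ext (Psi_gamma a).symm)
    | neg z hz =>
      obtain ⟨b, hb⟩ := hz
      refine ⟨-b, ?_⟩
      rw [map_neg, hb, ← map_neg]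
      exact congrArg _ (Subtype.ext (map_neg (Psi B) z).symm)
    | add z w hz hw =>
      obtain ⟨b, hb⟩ := hz
      obtain ⟨c, hc⟩ := hw
      refine ⟨b + c, ?_⟩
      rw [map_add, hb, hc, ← map_add]
      exact congrArg _ (Subtype.ext (map_add (Psi B) z w).symm)
  exact hK z

/-- If `b` is not in `2B`, some `χ : B → ℤ/2` has `χ(b) ≠ 0`. The functional `a ⊗ b ↦ χ(a) χ(b)` is
symmetric, hence zero on norms in characteristic two, but not on `b ⊗ b`. Conversely `2c ⊗ 2c` is
the norm of `2 (c ⊗ c)`. -/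
theorem squareClass_eq_zero_iff (b : B) : squareClass B b = 0 ↔ ∃ c, b = (2 : ℤ) • c := by
  constructor
  · intro h
    by_contra hne
    push Not at hne
    obtain ⟨χ, hχ⟩ := exists_zmod_hom_ne_zero 2 (z := b) fun y hy => hne y (by
      rw [hy, ← natCast_zsmul]; rfl)
    rw [squareClass_apply, H1mk_eq_zero_iff] at h
    obtain ⟨y, hy⟩ := h
    let μ : B ⊗[ℤ] B →ₗ[ℤ] ZMod 2 :=
      (LinearMap.mul' ℤ _).comp (TensorProduct.map χ.toIntLinearMap χ.toIntLinearMap)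
    have hμ : ∀ y, μ (swap B y) = μ y := by
      intro y
      induction y with
      | zero => simp
      | tmul a b => exact mul_comm (χ b) (χ a)
      | add x y hx hy => rw [map_add, map_add, map_add, hx, hy]
    have h1 : χ b * χ b = 0 := by
      change μ (b ⊗ₜ b) = 0
      have h2 : μ (y + swap B y) = μ (b ⊗ₜ b) := congrArg μ hy
      rw [← h2, map_add, hμ]
      exact CharTwo.add_self_eq_zero _
    exact hχ (mul_self_eq_zero.1 h1)
  · rintro ⟨c, rfl⟩
    refine H1mk_eq_zero_of_eq_two (swap_swap B) (w := (2 : ℤ) • (c ⊗ₜ[ℤ] c)) ?_ ?_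
    · rw [map_zsmul, swap_tmul]
    · change ((2 : ℤ) • c) ⊗ₜ[ℤ] ((2 : ℤ) • c) = _
      simp only [two_smul, TensorProduct.add_tmul, TensorProduct.tmul_add]

theorem H1SquareMap_squareClass {C : Type u} [AddCommGroup C] (f : B →+ C) (b : B) :
    H1SquareMap f (squareClass B b) = squareClass C (f b) :=
  H1map_H1mk _ _ _

end Diagonal

/-! ### `H₁` of the limit -/

section TorH1

variable {A : Type u} [AddCommGroup A]

/-- The homomorphism `a ↦ [τₙ(a, a)]`. -/
def torClass (n : ℕ) : tors A n →+ H1TorLim A :=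
  H1diag (torLimSwap_swap A) (torTau A n) (torLimSwap_torTau n)

theorem torClass_apply (n : ℕ) (a : tors A n) :
    torClass n a = H1mk (torLimSwap A) (torLimSwap_swap A)
      ⟨torTau A n a a, torLimSwap_torTau n a a⟩ := rfl

theorem toH1TorLim_squareClass (n : ℕ) (a : tors A n) :
    toH1TorLim A n (squareClass _ a) = torClass n a :=
  H1map_H1mk _ _ _

/-- The homomorphism `x ↦ [τₙ₊₁(x, x)]` on a graded piece. -/
def grTor (n : ℕ) : gr A n →+ H1TorLim A :=
  QuotientAddGroup.lift (grSub A n) (torClass (n + 1)) <| by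
    intro x hx
    obtain ⟨u, y, rfl⟩ := exists_decomposition hx
    rw [AddMonoidHom.mem_ker, map_add]
    -- The sliding relations give `τₙ₊₁(u, u) = τₙ(u, 2u) = 2 τₙ(u, u)` and `τₙ₊₁(2y, 2y) = τₙ₊₂(y,
    -- 2y) = 2 τₙ₊₂(y, y)`. The double of a fixed element is a norm.
    have h1 : torClass (n + 1) (torsIncl n.le_succ u) = 0 := by
      refine H1mk_eq_zero_of_eq_two (torLimSwap_swap A) (w := torTau A n u u)
        (torLimSwap_torTau n u u) ?_
      change torTau A (n + 1) (torsIncl n.le_succ u) (torsIncl n.le_succ u) = _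
      have hm : torsMul n.le_succ (torsIncl n.le_succ u) = u + u := by
        refine Subtype.ext ?_
        change (2 : ℤ) ^ (n + 1 - n) • (u : A) = (u : A) + u
        rw [show n + 1 - n = 1 by omega, pow_one, two_smul]
      rw [torTau_incl_left, hm, map_add]
    have h2 : torClass (n + 1) (torsMul (n + 1).le_succ y) = 0 := by
      refine H1mk_eq_zero_of_eq_two (torLimSwap_swap A) (w := torTau A (n + 2) y y)
        (torLimSwap_torTau (n + 2) y y) ?_
      change torTau A (n + 1) (torsMul (n + 1).le_succ y) (torsMul (n + 1).le_succ y) = _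
      have hm : torsIncl (n + 1).le_succ (torsMul (n + 1).le_succ y) = y + y := by
        refine Subtype.ext ?_
        change (2 : ℤ) ^ (n + 2 - (n + 1)) • (y : A) = (y : A) + y
        rw [show n + 2 - (n + 1) = 1 by omega, pow_one, two_smul]
      rw [← torTau_incl_right, hm, map_add]
    rw [h1, h2, add_zero]

theorem grTor_mk (n : ℕ) (x : tors A (n + 1)) :
    grTor (A := A) n (QuotientAddGroup.mk x) = torClass (n + 1) x := rfl

variable (A) in
/-- The map from the sum of the graded pieces to `H₁` of the limit. -/
def sumTor : (⨁ n, gr A n) →+ H1TorLim A := DirectSum.toAddMonoid (grTor (A := A))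

theorem torClass_mem_range (n : ℕ) (a : tors A n) : torClass n a ∈ (sumTor A).range := by
  cases n with
  | zero => rw [eq_zero_of_tors_zero a, map_zero]; exact zero_mem _
  | succ n =>
    refine ⟨DirectSum.of (gr A) n (QuotientAddGroup.mk a), ?_⟩
    rw [sumTor, DirectSum.toAddMonoid_of]
    rfl

theorem sumTor_surjective : Function.Surjective (sumTor A) := by
  intro y
  obtain ⟨⟨x, hx⟩, rfl⟩ := H1mk_surjective _ _ y
  -- `H1mk` is defined on fixed elements only, so the subgroup of good elements is pushed forward to
  -- the whole limit before comparison with `torDiagonal`.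
  have hle : torDiagonal A ≤ ((sumTor A).range.comap
      (H1mk (torLimSwap A) (torLimSwap_swap A))).map (fixedPoints (torLimSwap A)).subtype := by
    rw [torDiagonal, AddSubgroup.closure_le]
    rintro _ ⟨n, a, rfl⟩
    exact ⟨⟨torTau A n a a, torLimSwap_torTau n a a⟩, torClass_mem_range n a, rfl⟩
  obtain ⟨x', h, h'⟩ := hle (mem_torDiagonal_of_swap_eq hx)
  obtain rfl : x' = ⟨x, hx⟩ := Subtype.ext h'
  exact h

/-- A homomorphism on a graded piece, extended by zero to the other torsion subgroups. -/
def grExtend {n : ℕ} (χ : gr A n →+ ZMod 2) (m : ℕ) : tors A m →+ ZMod 2 :=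
  if h : m = n + 1 then (χ.comp (QuotientAddGroup.mk' (grSub A n))).comp (torsIncl h.le) else 0

theorem grExtend_self {n : ℕ} (χ : gr A n →+ ZMod 2) (a : tors A (n + 1)) :
    grExtend χ (n + 1) a = χ (QuotientAddGroup.mk a) := by
  rw [grExtend, dif_pos rfl]
  rfl

theorem grExtend_of_ne {n m : ℕ} (χ : gr A n →+ ZMod 2) (h : m ≠ n + 1) : grExtend χ m = 0 :=
  dif_neg h

/-- Elements of smaller torsion have zero class in the graded piece, as do proper `2`-power
multiples in `grExtend_torsMul`. Hence both sides of every sliding relation between distinct indices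
vanish, and the extension by zero defines a functional on the limit. -/
theorem grExtend_torsIncl {n k m : ℕ} (χ : gr A n →+ ZMod 2) (h : k < m) (a : tors A k) :
    grExtend χ m (torsIncl h.le a) = 0 := by
  rcases eq_or_ne m (n + 1) with rfl | hm
  · rw [grExtend_self, (QuotientAddGroup.eq_zero_iff _).2
      (torsIncl_mem_grSub (Nat.lt_succ_iff.1 h) _ a), map_zero]
  · rw [grExtend_of_ne χ hm, AddMonoidHom.zero_apply]

theorem grExtend_torsMul {n k m : ℕ} (χ : gr A n →+ ZMod 2) (h : k < m) (a : tors A m) :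
    grExtend χ k (torsMul h.le a) = 0 := by
  rcases eq_or_ne k (n + 1) with rfl | hk
  · rw [grExtend_self, (QuotientAddGroup.eq_zero_iff _).2 (torsMul_mem_grSub h a), map_zero]
  · rw [grExtend_of_ne χ hk, AddMonoidHom.zero_apply]

theorem torsIncl_refl {k : ℕ} (h : k ≤ k) (a : tors A k) : torsIncl h a = a := rfl

theorem torsMul_refl {k : ℕ} (h : k ≤ k) (a : tors A k) : torsMul h a = a := by
  refine Subtype.ext ?_
  change (2 : ℤ) ^ (k - k) • (a : A) = a
  rw [Nat.sub_self, pow_zero, one_smul]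

/-- The functional `τₙ₊₁(a, b) ↦ χ(a) χ(b)`, zero on the other generators. -/
def torFunctional {n : ℕ} (χ : gr A n →+ ZMod 2) : torLim A →+ ZMod 2 :=
  torLift (fun m => (AddMonoidHom.mul.compl₂ (grExtend χ m)).comp (grExtend χ m))
    (fun k m h a b => by
      change grExtend χ m a * grExtend χ m (torsIncl h b) =
        grExtend χ k (torsMul h a) * grExtend χ k b
      rcases h.eq_or_lt with rfl | hlt
      · rw [torsIncl_refl, torsMul_refl]
      · rw [grExtend_torsIncl χ hlt, grExtend_torsMul χ hlt, mul_zero, zero_mul])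
    (fun k m h a b => by
      change grExtend χ m (torsIncl h a) * grExtend χ m b =
        grExtend χ k a * grExtend χ k (torsMul h b)
      rcases h.eq_or_lt with rfl | hlt
      · rw [torsIncl_refl, torsMul_refl]
      · rw [grExtend_torsIncl χ hlt, grExtend_torsMul χ hlt, mul_zero, zero_mul])

theorem torFunctional_torTau {n : ℕ} (χ : gr A n →+ ZMod 2) (m : ℕ) (a b : tors A m) :
    torFunctional χ (torTau A m a b) = grExtend χ m a * grExtend χ m b :=
  torLift_torTau _ _ _ m a b

theorem torFunctional_swap {n : ℕ} (χ : gr A n →+ ZMod 2) (x : torLim A) :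
    torFunctional χ (torLimSwap A x) = torFunctional χ x := by
  refine DFunLike.congr_fun (f := (torFunctional χ).comp (torLimSwap A))
    (g := torFunctional χ) ?_ x
  exact torLim_hom_ext fun m a b => by
    rw [AddMonoidHom.comp_apply, torLimSwap_torTau, torFunctional_torTau, torFunctional_torTau,
      mul_comm]

theorem two_zsmul_gr (n : ℕ) (g : gr A n) : (2 : ℤ) • g = 0 := by
  obtain ⟨x, rfl⟩ := QuotientAddGroup.mk_surjective g
  refine (QuotientAddGroup.eq_zero_iff ((2 : ℤ) • x)).2 ⟨x, ?_⟩
  rw [AddSubgroup.coe_zsmul, smul_smul, pow_succ]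

/-- A nonzero `g` in the group `gr A n` of exponent two is detected by some `χ` to `ℤ/2`. The
symmetric functional `torFunctional χ` kills norms, descends to `H₁`, vanishes on the other pieces
and takes the value `χ(g)²` on `g`. -/
theorem sumTor_injective : Function.Injective (sumTor A) := by
  refine toAddMonoid_injective _ fun n g hg => ?_
  obtain ⟨χ, hχ⟩ := exists_zmod_hom_ne_zero 2 (z := g) fun y hy => hg (by
    rw [hy, ← natCast_zsmul]; exact two_zsmul_gr n y)
  refine ⟨ZMod 2, inferInstance, H1desc (torLimSwap A) (torLimSwap_swap A)
    ((torFunctional χ).comp (fixedPoints _).subtype) ?_, fun m hm z => ?_, ?_⟩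
  · rintro ⟨_, h⟩ ⟨y, rfl⟩
    change torFunctional χ (y + torLimSwap A y) = 0
    rw [map_add, torFunctional_swap]
    exact CharTwo.add_self_eq_zero _
  · obtain ⟨a, rfl⟩ := QuotientAddGroup.mk_surjective z
    rw [grTor_mk, torClass_apply, H1desc_H1mk]
    change torFunctional χ (torTau A (m + 1) a a) = 0
    rw [torFunctional_torTau, grExtend_of_ne χ (by omega), AddMonoidHom.zero_apply, zero_mul]
  · obtain ⟨a, rfl⟩ := QuotientAddGroup.mk_surjective g
    rw [grTor_mk, torClass_apply, H1desc_H1mk]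
    change torFunctional χ (torTau A (n + 1) a a) ≠ 0
    rw [torFunctional_torTau, grExtend_self]
    exact mul_self_ne_zero.2 hχ

theorem mem_iSup_range_toH1TorLim (x : H1TorLim A) :
    x ∈ ⨆ n : ℕ, LinearMap.range (toH1TorLim A n) := by
  obtain ⟨g, rfl⟩ := sumTor_surjective x
  induction g using DirectSum.induction_on with
  | zero => rw [map_zero]; exact zero_mem _
  | of n z =>
    obtain ⟨a, rfl⟩ := QuotientAddGroup.mk_surjective z
    rw [sumTor, DirectSum.toAddMonoid_of, grTor_mk, ← toH1TorLim_squareClass]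
    exact Submodule.mem_iSup_of_mem (n + 1) (LinearMap.mem_range_self _ _)
  | add y z hy hz => rw [map_add]; exact add_mem hy hz

end TorH1

/-! ### The `2`-torsion modulo `2` -/

section TorsionModTwo

variable {A : Type u} [AddCommGroup A]

/-- In a group of exponent two every subgroup has a complementary projection. -/
theorem exists_projection {W : Type u} [AddCommGroup W] (hW : ∀ w : W, (2 : ℕ) • w = 0)
    (K : AddSubgroup W) : ∃ p : W →+ W, (∀ k ∈ K, p k = 0) ∧ ∀ w, w - p w ∈ K := by
  let _ : Module (ZMod 2) W := AddCommGroup.zmodModule hW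
  let K' : Submodule (ZMod 2) W := AddSubgroup.toZModSubmodule 2 K
  obtain ⟨q, hq⟩ := K'.subtype.exists_leftInverse_of_injective K'.ker_subtype
  have hq' : ∀ k : K', q k = k := fun k => LinearMap.congr_fun hq k
  refine ⟨AddMonoidHom.id W - (K'.subtype.comp q).toAddMonoidHom, fun k hk => ?_, fun w => ?_⟩
  · change k - (q k : W) = 0
    rw [show q k = ⟨k, hk⟩ from hq' ⟨k, hk⟩, sub_self]
  · change w - (w - (q w : W)) ∈ K
    rw [sub_sub_cancel]
    exact (q w).2

/-- The inclusion of the `2ⁿ`-torsion in the `2`-power torsion. -/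
def torsInclInf (n : ℕ) : tors A n →+ torsInf A :=
  AddSubgroup.inclusion (le_iSup (tors A) n)

theorem exists_torsInclInf (x : torsInf A) : ∃ (n : ℕ) (a : tors A n), torsInclInf n a = x := by
  obtain ⟨n, h⟩ := mem_torsInf.1 x.2
  exact ⟨n, ⟨x, h⟩, rfl⟩

/-- The reduction of the `2`-power torsion modulo `2` is (noncanonically) the sum of the graded
pieces. -/
theorem nonempty_gr_addEquiv {W : Type u} [AddCommGroup W] (w : torsInf A →+ W)
    (hw : Function.Surjective w) (hker : ∀ x, w x = 0 ↔ ∃ c, x = (2 : ℤ) • c) :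
    Nonempty ((⨁ n, gr A n) ≃+ W) := by
  have hW : ∀ y : W, (2 : ℕ) • y = 0 := by
    intro y
    obtain ⟨x, rfl⟩ := hw y
    rw [← map_nsmul]
    exact (hker _).2 ⟨x, (natCast_zsmul x 2).symm⟩
  -- The filtration of `W` by the images of the `2ⁿ`-torsion; `hsub` identifies the quotient of `K
  -- (n + 1)` by `K n` with `gr A n`.
  let K : ℕ → AddSubgroup W := fun n => (w.comp (torsInclInf n)).range
  have hmono : ∀ {m n : ℕ}, m ≤ n → K m ≤ K n := by
    rintro m n h _ ⟨a, rfl⟩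
    exact ⟨torsIncl h a, rfl⟩
  choose p hp0 hp using fun n => exists_projection hW (K n)
  have hsub : ∀ n (x : tors A (n + 1)),
      w (torsInclInf (n + 1) x) ∈ K n ↔ x ∈ grSub A n := by
    intro n x
    constructor
    · rintro ⟨a, ha⟩
      have h : w (torsInclInf (n + 1) x - torsInclInf n a) = 0 := by
        rw [map_sub, ← ha, AddMonoidHom.comp_apply, sub_self]
      obtain ⟨c, hc⟩ := (hker _).1 h
      have hc' : (x : A) - a = (2 : ℤ) • (c : A) := congrArg Subtype.val hc
      have ha' : (2 : ℤ) ^ n • (a : A) = 0 := a.2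
      refine ⟨c, ?_⟩
      rw [pow_succ, mul_smul, ← hc', smul_sub, ha', sub_zero]
    · intro hx
      obtain ⟨a, y, rfl⟩ := exists_decomposition hx
      refine ⟨a, ?_⟩
      have hy : w (torsInclInf (n + 1) (torsMul (n + 1).le_succ y)) = 0 := by
        refine (hker _).2 ⟨torsInclInf (n + 2) y, Subtype.ext ?_⟩
        change (2 : ℤ) ^ (n + 2 - (n + 1)) • (y : A) = (2 : ℤ) • (y : A)
        rw [show n + 2 - (n + 1) = 1 by omega, pow_one]
      rw [map_add, map_add, hy, add_zero]
      rfl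
  -- The projection `p n` along `K n` chooses representatives of the graded piece in `W`; this
  -- choice is not canonical.
  let σ : ∀ n, gr A n →+ W := fun n =>
    QuotientAddGroup.lift (grSub A n) ((p n).comp (w.comp (torsInclInf (n + 1)))) fun x hx =>
      hp0 n _ ((hsub n x).2 hx)
  have hσ : ∀ n (x : tors A (n + 1)),
      σ n (QuotientAddGroup.mk x) = p n (w (torsInclInf (n + 1) x)) := fun _ _ => rfl
  have hσK : ∀ n (g : gr A n), σ n g ∈ K (n + 1) := by
    intro n g
    obtain ⟨x, rfl⟩ := QuotientAddGroup.mk_surjective g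
    rw [hσ]
    have h := sub_mem (show w (torsInclInf (n + 1) x) ∈ K (n + 1) from ⟨x, rfl⟩)
      (hmono n.le_succ (hp n (w (torsInclInf (n + 1) x))))
    rwa [sub_sub_cancel] at h
  have hrange : ∀ n, K n ≤ (DirectSum.toAddMonoid σ).range := by
    intro n
    induction n with
    | zero =>
      rintro _ ⟨a, rfl⟩
      rw [eq_zero_of_tors_zero a, map_zero]
      exact zero_mem _
    | succ n ih =>
      rintro _ ⟨x, rfl⟩
      have h1 := ih (hp n (w (torsInclInf (n + 1) x)))
      have h2 : p n (w (torsInclInf (n + 1) x)) ∈ (DirectSum.toAddMonoid σ).range :=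
        ⟨DirectSum.of (gr A) n (QuotientAddGroup.mk x), DirectSum.toAddMonoid_of _ _ _⟩
      have h3 := add_mem h1 h2
      rwa [sub_add_cancel] at h3
  have hinj : Function.Injective (DirectSum.toAddMonoid σ) := by
    classical
    refine (injective_iff_map_eq_zero _).2 fun g hg => ?_
    by_contra hne
    have hs : (DFinsupp.support g).Nonempty := by
      rw [Finset.nonempty_iff_ne_empty, Ne, DFinsupp.support_eq_empty]
      exact hne
    -- The terms of index below the largest index `N` lie in `K N`, hence so does the leading one.
    -- That one is congruent modulo `K N` to the image under `w` of a representative of `g N`, so `g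
    -- N = 0`.
    obtain ⟨N, hN, hmax⟩ := (DFinsupp.support g).exists_max_image id hs
    have hsum : DirectSum.toAddMonoid σ g = ∑ i ∈ DFinsupp.support g, σ i (g i) := by
      conv_lhs => rw [← DirectSum.sum_support_of g]
      rw [map_sum]
      exact Finset.sum_congr rfl fun i _ => DirectSum.toAddMonoid_of _ _ _
    rw [hg, ← Finset.add_sum_erase _ _ hN] at hsum
    have hrest : ∑ i ∈ (DFinsupp.support g).erase N, σ i (g i) ∈ K N := by
      refine sum_mem fun i hi => hmono ?_ (hσK i (g i))
      rw [Finset.mem_erase] at hi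
      have h : i ≤ N := hmax i hi.2
      omega
    have hlead : σ N (g N) ∈ K N := by
      rw [eq_neg_of_add_eq_zero_left hsum.symm]
      exact neg_mem hrest
    obtain ⟨x, hx⟩ := QuotientAddGroup.mk_surjective (g N)
    rw [← hx, hσ] at hlead
    have hmem := add_mem (hp N (w (torsInclInf (N + 1) x))) hlead
    rw [sub_add_cancel, hsub] at hmem
    rw [DFinsupp.mem_support_iff, ← hx] at hN
    exact hN ((QuotientAddGroup.eq_zero_iff x).2 hmem)
  have hsurj : Function.Surjective (DirectSum.toAddMonoid σ) := by
    intro y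
    obtain ⟨x, rfl⟩ := hw y
    obtain ⟨n, a, rfl⟩ := exists_torsInclInf x
    exact hrange n ⟨a, rfl⟩
  exact ⟨AddEquiv.ofBijective _ ⟨hinj, hsurj⟩⟩

theorem H1SquareMap_torsInclInf {m n : ℕ} (h : m ≤ n) (x : H1Square (tors A m)) :
    H1SquareMap (torsInclInf n) (H1SquareMap (torsIncl h) x) =
      H1SquareMap (torsInclInf m) x := by
  obtain ⟨a, rfl⟩ := squareClass_surjective x
  rw [H1SquareMap_squareClass, H1SquareMap_squareClass, H1SquareMap_squareClass]
  rfl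

variable (A) in
/-- The canonical map from the direct limit to `H₁(Σ₂, T ⊗ T)`, `T` the `2`-power torsion. -/
def limH1ToInf : limH1 A →+ H1Square (torsInf A) :=
  (Module.DirectLimit.lift (ULift.{u} ℤ) ℕ (fun n : ℕ => H1Square (tors A n))
    (fun _ _ h => H1SquareMap (torsIncl h)) (fun n => H1SquareMap (torsInclInf n))
    (fun _ _ h x => H1SquareMap_torsInclInf h x)).toAddMonoidHom

/-- The canonical map to the direct limit. -/
def limH1Of (n : ℕ) : H1Square (tors A n) →+ limH1 A :=
  (Module.DirectLimit.of (ULift.{u} ℤ) ℕ (fun n : ℕ => H1Square (tors A n))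
    (fun _ _ h => H1SquareMap (torsIncl h)) n).toAddMonoidHom

theorem limH1Of_map {m n : ℕ} (h : m ≤ n) (x : H1Square (tors A m)) :
    limH1Of n (H1SquareMap (torsIncl h) x) = limH1Of m x :=
  Module.DirectLimit.of_f (G := fun n : ℕ => H1Square (tors A n))
    (f := fun _ _ h => H1SquareMap (torsIncl h)) (hij := h)

theorem exists_limH1Of (x : limH1 A) : ∃ n a, limH1Of n (squareClass (tors A n) a) = x := by
  obtain ⟨n, y, hy⟩ := Module.DirectLimit.exists_of (R := ULift.{u} ℤ)
    (G := fun n : ℕ => H1Square (tors A n)) (f := fun _ _ h => H1SquareMap (torsIncl h)) x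
  obtain ⟨a, rfl⟩ := squareClass_surjective y
  exact ⟨n, a, hy⟩

theorem limH1ToInf_limH1Of (n : ℕ) (x : H1Square (tors A n)) :
    limH1ToInf A (limH1Of n x) = H1SquareMap (torsInclInf n) x :=
  Module.DirectLimit.lift_of (R := ULift.{u} ℤ) (G := fun n : ℕ => H1Square (tors A n))
    (f := fun _ _ h => H1SquareMap (torsIncl h)) (fun n => H1SquareMap (torsInclInf n))
    (fun _ _ h x => H1SquareMap_torsInclInf h x) x

/-- Through `b ↦ [b ⊗ b]` this says that `B ↦ B/2B` commutes with the union of the torsion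
subgroups: if `a = 2c` in the union, then `c` lies in some stage, where `a` is already divisible by
`2`. -/
theorem limH1ToInf_bijective : Function.Bijective (limH1ToInf A) := by
  constructor
  · refine (injective_iff_map_eq_zero _).2 fun x hx => ?_
    obtain ⟨n, a, rfl⟩ := exists_limH1Of x
    rw [limH1ToInf_limH1Of, H1SquareMap_squareClass, squareClass_eq_zero_iff] at hx
    obtain ⟨c, hc⟩ := hx
    obtain ⟨m, b, rfl⟩ := exists_torsInclInf c
    have hab : torsIncl (le_max_left n m) a = (2 : ℤ) • torsIncl (le_max_right n m) b :=
      Subtype.ext (congrArg (Subtype.val : torsInf A → A) hc)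
    rw [← limH1Of_map (le_max_left n m), H1SquareMap_squareClass,
      (squareClass_eq_zero_iff _).2 ⟨_, hab⟩, map_zero]
  · intro y
    obtain ⟨x, rfl⟩ := squareClass_surjective y
    obtain ⟨n, a, rfl⟩ := exists_torsInclInf x
    exact ⟨limH1Of n (squareClass _ a),
      (limH1ToInf_limH1Of n _).trans (H1SquareMap_squareClass _ _)⟩

theorem exists_kernel_of_addEquiv {W : Type u} [AddCommGroup W] (e : W ≃+ ⨁ n, gr A n) :
    ∃ κ : W →+ Gamma A, Function.Injective κ ∧ Function.Exact κ (Psi A) := by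
  refine ⟨(sumGamma A).comp e.toAddMonoidHom, sumGamma_injective.comp e.injective, fun x => ?_⟩
  rw [sumGamma_exact x]
  constructor
  · rintro ⟨g, rfl⟩
    exact ⟨e.symm g, congrArg (sumGamma A) (e.apply_symm_apply g)⟩
  · rintro ⟨y, rfl⟩
    exact ⟨e y, rfl⟩

variable (A) in
theorem nonempty_gr_addEquiv_H1Square :
    Nonempty ((⨁ n, gr A n) ≃+ H1Square (torsInf A)) :=
  nonempty_gr_addEquiv (squareClass (torsInf A)) squareClass_surjective squareClass_eq_zero_iff

end TorsionModTwo

end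

end WhiteheadQuadratic

/-! ### The exact sequences -/

theorem mainTheorem2 (A : Type u) [AddCommGroup A] :
    ∃ π : A ⊗[ℤ] A →+ WhiteheadQuadratic.H2 A,
      (∀ a b : A, π (a ⊗ₜ b) = WhiteheadQuadratic.commClass a b) ∧
      Function.Surjective π ∧
      Function.Exact (WhiteheadQuadratic.Psi A) π ∧
      (∃ κ : WhiteheadQuadratic.limH1 A →+ WhiteheadQuadratic.Gamma A,
        Function.Injective κ ∧ Function.Exact κ (WhiteheadQuadratic.Psi A)) ∧
      ((∀ x : WhiteheadQuadratic.H1TorLim A,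
          x ∈ ⨆ n : ℕ, LinearMap.range (WhiteheadQuadratic.toH1TorLim A n)) ∧
        ∃ κ : WhiteheadQuadratic.H1TorLim A →+ WhiteheadQuadratic.Gamma A,
          Function.Injective κ ∧ Function.Exact κ (WhiteheadQuadratic.Psi A)) ∧
      (Finite (WhiteheadQuadratic.torsInf A) →
        ∃ κ : WhiteheadQuadratic.H1Square (WhiteheadQuadratic.torsInf A) →+
            WhiteheadQuadratic.Gamma A,
          Function.Injective κ ∧ Function.Exact κ (WhiteheadQuadratic.Psi A)) := by
  -- The noncanonical `e` serves for sense (a) and for the last sequence. In sense (b) the map `κ`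
  -- involves no choice: it sends `[τₙ(a, a)]` to `2ⁿ γ(a)`.
  obtain ⟨e⟩ := WhiteheadQuadratic.nonempty_gr_addEquiv_H1Square A
  refine ⟨WhiteheadQuadratic.commHom A, WhiteheadQuadratic.commHom_tmul,
    WhiteheadQuadratic.commHom_surjective, fun x => ⟨fun hx => ?_, ?_⟩, ?_,
    ⟨WhiteheadQuadratic.mem_iSup_range_toH1TorLim, ?_⟩, fun _ => ?_⟩
  · exact WhiteheadQuadratic.mem_range_Psi_of_swap_eq
      (WhiteheadQuadratic.swap_eq_of_commHom_eq_zero hx)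
  · rintro ⟨y, rfl⟩
    exact WhiteheadQuadratic.commHom_Psi y
  · exact WhiteheadQuadratic.exists_kernel_of_addEquiv
      ((AddEquiv.ofBijective (WhiteheadQuadratic.limH1ToInf A)
        WhiteheadQuadratic.limH1ToInf_bijective).trans e.symm)
  · exact WhiteheadQuadratic.exists_kernel_of_addEquiv
      (AddEquiv.ofBijective (WhiteheadQuadratic.sumTor A)
        ⟨WhiteheadQuadratic.sumTor_injective, WhiteheadQuadratic.sumTor_surjective⟩).symm
  · exact WhiteheadQuadratic.exists_kernel_of_addEquiv e.symm
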